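/- Let $k$ be a field and $G$ a finite group. Let $D(k[G])$ be the Drinfel'd double of $k[G]$: the bialgebra with basis $g\llcorner x$ ($g,x\in G$), multiplication $g\llcorner x\cdot h\llcorner y=\delta_{g,xhx^{-1}}\,g\llcorner xy$, unit $\sum_{g}g\llcorner e$, comultiplication $\Delta(g\llcorner x)=\sum_{g_1g_2=g}g_1\llcorner x\otimes g_2\llcorner x$ and counit $\varepsilon(g\llcorner x)=\delta_{g,e}$. For a $k$-algebra $A$ let $\mathrm{Rep}(A)$ be the Grothendieck group of finite-dimensional left $A$-modules modulo short exact sequences; for a bialgebra it is a ring under $\otimes_k$, with unit the trivial module. For a group $H$ write $\mathrm{Rep}(H)=\mathrm{Rep}(k[H])$. The inertia stack of $[pt/G]$ is the quotient $[G/G]$ of $G$ by conjugation. Let $K_{\rm full}([pt/G])=K([G/G])$ be the Grothendieck group, modulo short exact sequences, of finite-rank $G$-equivariant $k$-vector bundles on the finite set $G$ with conjugation action. Let $e_1,e_2,\check e_3:[(G\times G)/G]\to[G/G]$ be induced by $(m_1,m_2)\mapsto m_1$, $m_2$ and $m_1m_2$. Equip $K_{\rm full}([pt/G])$ with the stringy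 push-pull product $$\mathcal F*\mathcal F'=\check e_{3*}\bigl(e_1^*\mathcal F\otimes e_2^*\mathcal F'\bigr)$$ (the obstruction bundle is zero for a point) and with the class of the trivial line bundle supported on the untwisted sector $\{e\}\subset G$. Then: 1. There is an isomorphism $K_{\rm full}([pt/G])\cong \mathrm{Rep}(D(k[G]))$, additive, multiplicative and carrying the distinguished class above to $1$; in particular $K_{\rm full}([pt/G])$ is an associative ring with that class as unit, and this is an isomorphism of rings (with integral coefficients). 2. For every system of representatives $g_c$ of the conjugacy classes $c$ of $G$, with centralizers $Z(g_c)$, the map sending a bundle $E$ to the family of its fibres $(E_{g_c})_c$, considered as representations of $Z(g_c)$, induces an isomorphism of additive groups $K_{\rm full}([pt/G])\cong\bigoplus_{c}\mathrm{Rep}(Z(g_c))$. -/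

import Mathlib

open scoped TensorProduct DirectSum

universe u v w

noncomputable section

/-! Grothendieck groups -/

/-- The Grothendieck group of a class `T` of objects with a class of short exact sequences
`SES A B C` (read `0 → A → B → C → 0`): generators `[A]`, relations `[B] = [A] + [C]`. -/
def GrothendieckK (T : Type w) (SES : T → T → T → Prop) : Type w :=
  FreeAbelianGroup T ⧸ AddSubgroup.closure
    {z : FreeAbelianGroup T | ∃ A B C, SES A B C ∧
      z = FreeAbelianGroup.of B - FreeAbelianGroup.of A - FreeAbelianGroup.of C}

namespace GrothendieckK

variable {T : Type w} {SES : T → T → T → Prop}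

instance : AddCommGroup (GrothendieckK T SES) :=
  inferInstanceAs (AddCommGroup (FreeAbelianGroup T ⧸ AddSubgroup.closure
    {z : FreeAbelianGroup T | ∃ A B C, SES A B C ∧
      z = FreeAbelianGroup.of B - FreeAbelianGroup.of A - FreeAbelianGroup.of C}))

/-- The class `[A]` of an object. -/
def cls (SES : T → T → T → Prop) (A : T) : GrothendieckK T SES :=
  QuotientAddGroup.mk (FreeAbelianGroup.of A)

theorem cls_eq_add {A B C : T} (h : SES A B C) : cls SES B = cls SES A + cls SES C := by
  have h0 : (QuotientAddGroup.mk (FreeAbelianGroup.of B - FreeAbelianGroup.of A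
      - FreeAbelianGroup.of C) : GrothendieckK T SES) = 0 :=
    (QuotientAddGroup.eq_zero_iff _).2 (AddSubgroup.subset_closure ⟨A, B, C, h, rfl⟩)
  have h1 : cls SES B - cls SES A - cls SES C = 0 := h0
  rw [sub_sub, sub_eq_zero] at h1
  exact h1

/-- An additive invariant of objects factors through the Grothendieck group. -/
def lift {H : Type*} [AddCommGroup H] (f : T → H)
    (hf : ∀ A B C, SES A B C → f B = f A + f C) : GrothendieckK T SES →+ H :=
  QuotientAddGroup.lift _ (FreeAbelianGroup.lift f) (by
    rw [AddSubgroup.closure_le]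
    rintro _ ⟨A, B, C, h, rfl⟩
    simp [hf A B C h])

@[simp]
theorem lift_cls {H : Type*} [AddCommGroup H] (f : T → H)
    (hf : ∀ A B C, SES A B C → f B = f A + f C) (A : T) : lift f hf (cls SES A) = f A := by
  change FreeAbelianGroup.lift f (FreeAbelianGroup.of A) = f A
  simp

theorem hom_ext {H : Type*} [AddCommGroup H] {f g : GrothendieckK T SES →+ H}
    (h : ∀ A, f (cls SES A) = g (cls SES A)) : f = g := by
  apply QuotientAddGroup.addMonoidHom_ext
  apply FreeAbelianGroup.lift_ext
  exact h

/-- A bi-exact operation on objects induces a biadditive operation on the Grothendieck group. -/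
def lift₂ (f : T → T → T)
    (hl : ∀ A B C D, SES A B C → SES (f A D) (f B D) (f C D))
    (hr : ∀ A B C D, SES A B C → SES (f D A) (f D B) (f D C)) :
    GrothendieckK T SES →+ GrothendieckK T SES →+ GrothendieckK T SES :=
  lift (fun D => lift (fun A => cls SES (f D A))
      (fun A B C h => cls_eq_add (hr A B C D h)))
    (fun A B C h => hom_ext fun D => by
      simpa using cls_eq_add (hl A B C D h))

@[simp]
theorem lift₂_cls (f : T → T → T)
    (hl : ∀ A B C D, SES A B C → SES (f A D) (f B D) (f C D))
    (hr : ∀ A B C D, SES A B C → SES (f D A) (f D B) (f D C)) (A B : T) :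
    lift₂ f hl hr (cls SES A) (cls SES B) = cls SES (f A B) := by
  simp [lift₂]

end GrothendieckK

/-! Finite-dimensional modules and the representation ring of a bialgebra -/

/-- A finite-dimensional left module `(ρ, V)` over a `k`-algebra `A`. -/
structure FDModule (k : Type u) [Field k] (A : Type v) [Ring A] [Algebra k A] where
  V : Type (max u v)
  [addCommGroup : AddCommGroup V]
  [module : Module k V]
  [finiteDimensional : FiniteDimensional k V]
  ρ : A →ₐ[k] Module.End k V

namespace FDModule

attribute [instance] addCommGroup module finiteDimensional

variable {k : Type u} [Field k] {A : Type v} [Ring A] [Algebra k A]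

/-- There is a short exact sequence `0 → L → M → N → 0` of `A`-modules. -/
def IsSES (L M N : FDModule k A) : Prop :=
  ∃ (f : L.V →ₗ[k] M.V) (g : M.V →ₗ[k] N.V),
    (∀ a v, f (L.ρ a v) = M.ρ a (f v)) ∧ (∀ a v, g (M.ρ a v) = N.ρ a (g v)) ∧
    Function.Injective f ∧ Function.Exact f g ∧ Function.Surjective g

/-- A finite-dimensional representation of a group `H` as a module over `k[H]`. -/
def ofRepresentation {H : Type v} [Group H] {V : Type (max u v)} [AddCommGroup V] [Module k V]
    [FiniteDimensional k V] (ρ : Representation k H V) : FDModule k (MonoidAlgebra k H) where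
  V := V
  ρ := ρ.asAlgebraHom

end FDModule

/-- `Rep(A)`: the Grothendieck group of finite-dimensional left `A`-modules. -/
abbrev RepRing (k : Type u) [Field k] (A : Type v) [Ring A] [Algebra k A] : Type _ :=
  GrothendieckK (FDModule k A) FDModule.IsSES

/-- The class of a module in `Rep(A)`. -/
abbrev RepRing.cls {k : Type u} [Field k] {A : Type v} [Ring A] [Algebra k A]
    (M : FDModule k A) : RepRing k A :=
  GrothendieckK.cls FDModule.IsSES M

namespace FDModule

variable {k : Type u} [Field k] {A : Type v} [Ring A] [Algebra k A]

theorem cls_zero {Z : FDModule k A} (hZ : Subsingleton Z.V) : RepRing.cls Z = 0 := by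
  have h : IsSES Z Z Z := ⟨LinearMap.id, 0, by simp, by simp, fun _ _ _ => Subsingleton.elim _ _,
    fun x => ⟨fun _ => ⟨x, rfl⟩, fun _ => rfl⟩, fun x => ⟨0, Subsingleton.elim _ _⟩⟩
  have := GrothendieckK.cls_eq_add h
  simpa using this

theorem cls_congr {M N : FDModule k A} (e : M.V ≃ₗ[k] N.V)
    (he : ∀ a v, e (M.ρ a v) = N.ρ a (e v)) : RepRing.cls M = RepRing.cls N := by
  let Z : FDModule k A :=
    { V := PUnit
      ρ := 
        { toFun := fun _ => 0
          map_one' := Subsingleton.elim _ _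
          map_mul' := fun _ _ => Subsingleton.elim _ _
          map_zero' := rfl
          map_add' := fun _ _ => Subsingleton.elim _ _
          commutes' := fun _ => Subsingleton.elim _ _ } }
  have hZ : RepRing.cls Z = 0 := cls_zero (inferInstanceAs (Subsingleton PUnit))
  have h : IsSES M N Z := ⟨e.toLinearMap, 0, he, by simp, e.injective,
    fun x => ⟨fun _ => ⟨e.symm x, by simp⟩, fun _ => rfl⟩, fun x => ⟨0, rfl⟩⟩
  have := GrothendieckK.cls_eq_add h
  rw [show GrothendieckK.cls IsSES Z = 0 from hZ, add_zero] at this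
  exact this.symm

end FDModule

/-- For modules `(ρ, V)` and `(σ, W)`, the action of `A ⊗ A` on `V ⊗ W`. -/
def outerTensorRep {k : Type u} [Field k] {A : Type v} [Ring A] [Algebra k A]
    {V W : Type*} [AddCommGroup V] [Module k V] [AddCommGroup W] [Module k W]
    (ρ : A →ₐ[k] Module.End k V) (σ : A →ₐ[k] Module.End k W) :
    A ⊗[k] A →ₐ[k] Module.End k (V ⊗[k] W) :=
  (Module.endTensorEndAlgHom (R := k) (S := k) (A := k)).comp (Algebra.TensorProduct.map ρ σ)

/-- The action of a bialgebra `A` on `V ⊗ W` through the comultiplication. -/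
def tensorRep {k : Type u} [Field k] {A : Type v} [Ring A] [Bialgebra k A]
    {V W : Type*} [AddCommGroup V] [Module k V] [AddCommGroup W] [Module k W]
    (ρ : A →ₐ[k] Module.End k V) (σ : A →ₐ[k] Module.End k W) :
    A →ₐ[k] Module.End k (V ⊗[k] W) :=
  (outerTensorRep ρ σ).comp (Bialgebra.comulAlgHom k A)

/-- The action of a bialgebra `A` on `k` through the counit. -/
def trivialRep (k : Type u) [Field k] (A : Type v) [Ring A] [Bialgebra k A]
    (V : Type w) [AddCommGroup V] [Module k V] : A →ₐ[k] Module.End k V :=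
  (Algebra.lsmul k k V).comp (Bialgebra.counitAlgHom k A)

section tensorLemmas

variable {k : Type u} [Field k] {A : Type v} [Ring A] [Bialgebra k A]
  {V V' W W' U : Type*} [AddCommGroup V] [Module k V] [AddCommGroup V'] [Module k V']
  [AddCommGroup W] [Module k W] [AddCommGroup W'] [Module k W'] [AddCommGroup U] [Module k U]
  (ρ : A →ₐ[k] Module.End k V) (ρ' : A →ₐ[k] Module.End k V')
  (σ : A →ₐ[k] Module.End k W) (σ' : A →ₐ[k] Module.End k W') (τ : A →ₐ[k] Module.End k U)

theorem tensorRep_apply (a : A) :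
    tensorRep ρ σ a = outerTensorRep ρ σ (Coalgebra.comul (R := k) a) := rfl

@[simp]
theorem outerTensorRep_tmul (a b : A) :
    outerTensorRep ρ σ (a ⊗ₜ b) = TensorProduct.map (ρ a) (σ b) := rfl

theorem outerTensorRep_map (f : V →ₗ[k] V') (g : W →ₗ[k] W')
    (hf : ∀ a v, f (ρ a v) = ρ' a (f v)) (hg : ∀ a v, g (σ a v) = σ' a (g v))
    (t : A ⊗[k] A) (x : V ⊗[k] W) :
    TensorProduct.map f g (outerTensorRep ρ σ t x) =
      outerTensorRep ρ' σ' t (TensorProduct.map f g x) := by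
  induction t with
  | zero => simp
  | add s t hs ht => simp only [map_add, LinearMap.add_apply, hs, ht]
  | tmul a b =>
    induction x with
    | zero => simp
    | add x y hx hy => simp only [map_add, hx, hy]
    | tmul v w => simp [hf, hg]

theorem tensorRep_assoc (a : A) (x : (V ⊗[k] W) ⊗[k] U) :
    TensorProduct.assoc k V W U (tensorRep (tensorRep ρ σ) τ a x) =
      tensorRep ρ (tensorRep σ τ) a (TensorProduct.assoc k V W U x) := by
  let F : (A ⊗[k] A) ⊗[k] A →ₗ[k] Module.End k ((V ⊗[k] W) ⊗[k] U) :=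
    TensorProduct.lift
      ((TensorProduct.mapBilinear (RingHom.id k) (V ⊗[k] W) U (V ⊗[k] W) U).compl₁₂
        (outerTensorRep ρ σ).toLinearMap τ.toLinearMap)
  let F' : A ⊗[k] (A ⊗[k] A) →ₗ[k] Module.End k (V ⊗[k] (W ⊗[k] U)) :=
    TensorProduct.lift
      ((TensorProduct.mapBilinear (RingHom.id k) V (W ⊗[k] U) V (W ⊗[k] U)).compl₁₂
        ρ.toLinearMap (outerTensorRep σ τ).toLinearMap)
  have hF : ∀ t : A ⊗[k] A, outerTensorRep (tensorRep ρ σ) τ t =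
      F (LinearMap.rTensor A (Coalgebra.comul (R := k)) t) := by
    intro t
    induction t with
    | zero => simp
    | add s t hs ht => simp only [map_add, hs, ht]
    | tmul a b => simp [F, tensorRep_apply]
  have hF' : ∀ t : A ⊗[k] A, outerTensorRep ρ (tensorRep σ τ) t =
      F' (LinearMap.lTensor A (Coalgebra.comul (R := k)) t) := by
    intro t
    induction t with
    | zero => simp
    | add s t hs ht => simp only [map_add, hs, ht]
    | tmul a b => simp [F', tensorRep_apply]
  have key : ∀ (t : (A ⊗[k] A) ⊗[k] A) (x : (V ⊗[k] W) ⊗[k] U),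
      TensorProduct.assoc k V W U (F t x) =
        F' (TensorProduct.assoc k A A A t) (TensorProduct.assoc k V W U x) := by
    intro t x
    induction t with
    | zero => simp
    | add s t hs ht => simp only [map_add, LinearMap.add_apply, hs, ht]
    | tmul t c =>
      induction t with
      | zero => simp
      | add s t hs ht => simp only [map_add, TensorProduct.add_tmul, LinearMap.add_apply, hs, ht]
      | tmul a b =>
        induction x with
        | zero => simp
        | add x y hx hy => simp only [map_add, hx, hy]
        | tmul y w =>
          induction y with
          | zero => simp
          | add x y hx hy => simp only [map_add, TensorProduct.add_tmul, hx, hy]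
          | tmul u v => simp [F, F']
  rw [tensorRep_apply, tensorRep_apply, hF, hF', key, Coalgebra.coassoc_apply]

theorem trivialRep_tensorRep (e : W ≃ₗ[k] k) (a : A) (x : W ⊗[k] V) :
    (TensorProduct.congr e (LinearEquiv.refl k V) ≪≫ₗ TensorProduct.lid k V)
      (tensorRep (trivialRep k A W) ρ a x) =
    ρ a ((TensorProduct.congr e (LinearEquiv.refl k V) ≪≫ₗ TensorProduct.lid k V) x) := by
  have key : ∀ t : A ⊗[k] A,
      (TensorProduct.congr e (LinearEquiv.refl k V) ≪≫ₗ TensorProduct.lid k V)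
        (outerTensorRep (trivialRep k A W) ρ t x) =
      ρ (TensorProduct.lid k A (LinearMap.rTensor A (Coalgebra.counit (R := k)) t))
        ((TensorProduct.congr e (LinearEquiv.refl k V) ≪≫ₗ TensorProduct.lid k V) x) := by
    intro t
    induction t with
    | zero => simp
    | add s t hs ht => simp only [map_add, LinearMap.add_apply, hs, ht]
    | tmul a b =>
      induction x with
      | zero => simp
      | add x y hx hy => simp only [map_add, hx, hy]
      | tmul r v => simp [trivialRep, smul_smul, mul_comm]
  rw [tensorRep_apply, key, Coalgebra.rTensor_counit_comul]
  simp

theorem tensorRep_trivialRep (e : W ≃ₗ[k] k) (a : A) (x : V ⊗[k] W) :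
    (TensorProduct.congr (LinearEquiv.refl k V) e ≪≫ₗ TensorProduct.rid k V)
      (tensorRep ρ (trivialRep k A W) a x) =
    ρ a ((TensorProduct.congr (LinearEquiv.refl k V) e ≪≫ₗ TensorProduct.rid k V) x) := by
  have key : ∀ t : A ⊗[k] A,
      (TensorProduct.congr (LinearEquiv.refl k V) e ≪≫ₗ TensorProduct.rid k V)
        (outerTensorRep ρ (trivialRep k A W) t x) =
      ρ (TensorProduct.rid k A (LinearMap.lTensor A (Coalgebra.counit (R := k)) t))
        ((TensorProduct.congr (LinearEquiv.refl k V) e ≪≫ₗ TensorProduct.rid k V) x) := by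
    intro t
    induction t with
    | zero => simp
    | add s t hs ht => simp only [map_add, LinearMap.add_apply, hs, ht]
    | tmul a b =>
      induction x with
      | zero => simp
      | add x y hx hy => simp only [map_add, hx, hy]
      | tmul r v => simp [trivialRep, smul_smul, mul_comm]
  rw [tensorRep_apply, key, Coalgebra.lTensor_counit_comul]
  simp

end tensorLemmas

namespace FDModule

variable {k : Type u} [Field k] {A : Type v} [Ring A] [Bialgebra k A]

/-- The tensor product of two modules. -/
def tensor (M N : FDModule k A) : FDModule k A where
  V := M.V ⊗[k] N.V
  ρ := tensorRep M.ρ N.ρ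

/-- The trivial one-dimensional module. -/
def trivial (k : Type u) [Field k] (A : Type v) [Ring A] [Bialgebra k A] : FDModule k A where
  V := ULift.{v} k
  ρ := trivialRep k A (ULift.{v} k)

theorem isSES_tensor_left (L M N D : FDModule k A) (h : IsSES L M N) :
    IsSES (tensor L D) (tensor M D) (tensor N D) := by
  obtain ⟨f, g, hf, hg, hi, he, hs⟩ := h
  refine ⟨f.rTensor D.V, g.rTensor D.V, fun a v => ?_, fun a v => ?_, ?_, ?_, ?_⟩
  · exact outerTensorRep_map _ _ _ _ f LinearMap.id hf (fun _ _ => rfl) _ v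
  · exact outerTensorRep_map _ _ _ _ g LinearMap.id hg (fun _ _ => rfl) _ v
  · exact Module.Flat.rTensor_preserves_injective_linearMap f hi
  · exact rTensor_exact D.V he hs
  · exact LinearMap.rTensor_surjective D.V hs

theorem isSES_tensor_right (L M N D : FDModule k A) (h : IsSES L M N) :
    IsSES (tensor D L) (tensor D M) (tensor D N) := by
  obtain ⟨f, g, hf, hg, hi, he, hs⟩ := h
  refine ⟨f.lTensor D.V, g.lTensor D.V, fun a v => ?_, fun a v => ?_, ?_, ?_, ?_⟩
  · exact outerTensorRep_map _ _ _ _ LinearMap.id f (fun _ _ => rfl) hf _ v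
  · exact outerTensorRep_map _ _ _ _ LinearMap.id g (fun _ _ => rfl) hg _ v
  · exact Module.Flat.lTensor_preserves_injective_linearMap f hi
  · exact lTensor_exact D.V he hs
  · exact LinearMap.lTensor_surjective D.V hs

end FDModule

namespace RepRing

variable {k : Type u} [Field k] {A : Type v} [Ring A] [Bialgebra k A]

/-- The product of `Rep(A)`, induced by the tensor product of modules. -/
def mulHom : RepRing k A →+ RepRing k A →+ RepRing k A :=
  GrothendieckK.lift₂ FDModule.tensor FDModule.isSES_tensor_left FDModule.isSES_tensor_right

instance : Mul (RepRing k A) := ⟨fun x y => mulHom x y⟩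

instance : One (RepRing k A) := ⟨cls (FDModule.trivial k A)⟩

theorem cls_mul_cls (M N : FDModule k A) : cls M * cls N = cls (FDModule.tensor M N) :=
  GrothendieckK.lift₂_cls _ _ _ _ _

theorem one_def : (1 : RepRing k A) = cls (FDModule.trivial k A) := rfl

theorem mul_def (x y : RepRing k A) : x * y = mulHom x y := rfl

/-- The representation ring `Rep(A)` of a bialgebra `A`. -/
instance : Ring (RepRing k A) :=
  { (inferInstance : AddCommGroup (RepRing k A)) with
    mul := (· * ·)
    one := 1
    left_distrib := fun x y z => map_add (mulHom x) y z
    right_distrib := fun x y z => DFunLike.congr_fun (map_add mulHom x y) z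
    zero_mul := fun x => DFunLike.congr_fun (map_zero mulHom) x
    mul_zero := fun x => map_zero (mulHom x)
    one_mul := by
      intro x
      have : mulHom (1 : RepRing k A) = AddMonoidHom.id _ := GrothendieckK.hom_ext fun M =>
        (cls_mul_cls _ M).trans
          (FDModule.cls_congr _ (trivialRep_tensorRep M.ρ ULift.moduleEquiv))
      exact DFunLike.congr_fun this x
    mul_one := by
      intro x
      have : mulHom.flip (1 : RepRing k A) = AddMonoidHom.id _ := GrothendieckK.hom_ext fun M =>
        (cls_mul_cls M _).trans
          (FDModule.cls_congr _ (tensorRep_trivialRep M.ρ ULift.moduleEquiv))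
      exact DFunLike.congr_fun this x
    mul_assoc := by
      intro x y z
      have h0 : ∀ L M N : FDModule k A, cls L * cls M * cls N = cls L * (cls M * cls N) := by
        intro L M N
        rw [cls_mul_cls, cls_mul_cls, cls_mul_cls, cls_mul_cls]
        exact FDModule.cls_congr (TensorProduct.assoc k L.V M.V N.V)
          (tensorRep_assoc L.ρ M.ρ N.ρ)
      have h1 : ∀ (L M : FDModule k A), mulHom (mulHom (cls L) (cls M)) =
          (mulHom (cls L)).comp (mulHom (cls M)) :=
        fun L M => GrothendieckK.hom_ext fun N => h0 L M N
      have h2 : ∀ (L : FDModule k A) (z : RepRing k A),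
          (mulHom.flip z).comp (mulHom (cls L)) = (mulHom (cls L)).comp (mulHom.flip z) :=
        fun L z => GrothendieckK.hom_ext fun M => DFunLike.congr_fun (h1 L M) z
      have h3 : (mulHom.flip z).comp (mulHom.flip y) = mulHom.flip (mulHom y z) :=
        GrothendieckK.hom_ext fun L => DFunLike.congr_fun (h2 L z) y
      exact DFunLike.congr_fun h3 x }

end RepRing

/-! The Drinfel'd double of a group ring -/

/-- The underlying vector space of the Drinfel'd double `D(k[G])`, with basis indexed by pairs
`(g, x)`. -/
def DrinfeldDouble (k : Type u) [Field k] (G : Type v) : Type (max u v) := (G × G) →₀ k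

namespace DrinfeldDouble

variable {k : Type u} [Field k] {G : Type v}

instance : AddCommGroup (DrinfeldDouble k G) := inferInstanceAs (AddCommGroup ((G × G) →₀ k))

instance : Module k (DrinfeldDouble k G) := inferInstanceAs (Module k ((G × G) →₀ k))

/-- The basis element usually written as `g` and `x` separated by a corner. -/
def elt (k : Type u) [Field k] {G : Type v} (g x : G) : DrinfeldDouble k G :=
  Finsupp.single (g, x) (1 : k)

/-- The elements `elt k g x` form a basis. -/
def basis (k : Type u) [Field k] (G : Type v) : Module.Basis (G × G) k (DrinfeldDouble k G) :=
  Module.Basis.ofRepr (LinearEquiv.refl k ((G × G) →₀ k))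

@[simp]
theorem basis_apply (p : G × G) : basis k G p = elt k p.1 p.2 := rfl

theorem hom_ext {M : Type*} [AddCommGroup M] [Module k M] {f f' : DrinfeldDouble k G →ₗ[k] M}
    (h : ∀ g x, f (elt k g x) = f' (elt k g x)) : f = f' :=
  (basis k G).ext fun p => h p.1 p.2

/-- The unit is `∑ g, (g, e)`. -/
instance [Group G] [Fintype G] : One (DrinfeldDouble k G) := ⟨∑ g : G, elt k g 1⟩

theorem one_def [Group G] [Fintype G] : (1 : DrinfeldDouble k G) = ∑ g : G, elt k g 1 := rfl

variable [Group G] [DecidableEq G]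

/-- The bilinear multiplication determined on basis elements by
`(g, x) (h, y) = δ_{g, x h x⁻¹} (g, x y)`. -/
def mulHom : DrinfeldDouble k G →ₗ[k] DrinfeldDouble k G →ₗ[k] DrinfeldDouble k G :=
  (basis k G).constr k fun p => (basis k G).constr k fun q =>
    if p.1 = p.2 * q.1 * p.2⁻¹ then elt k p.1 (p.2 * q.2) else 0

instance : Mul (DrinfeldDouble k G) := ⟨fun a b => mulHom a b⟩

theorem mul_def (a b : DrinfeldDouble k G) : a * b = mulHom a b := rfl

theorem elt_mul_elt (g x h y : G) :
    elt k g x * elt k h y = if g = x * h * x⁻¹ then elt k g (x * y) else 0 := by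
  have h1 : elt k g x = basis k G (g, x) := rfl
  have h2 : elt k h y = basis k G (h, y) := rfl
  rw [mul_def, mulHom, h1, h2, Module.Basis.constr_basis, Module.Basis.constr_basis]

theorem mulHom_elt (g x h y : G) : mulHom (elt k g x) (elt k h y) =
    if g = x * h * x⁻¹ then elt k g (x * y) else 0 := elt_mul_elt g x h y

variable [Fintype G]

instance : Ring (DrinfeldDouble k G) :=
  { (inferInstance : AddCommGroup (DrinfeldDouble k G)) with
    mul := (· * ·)
    one := 1
    left_distrib := fun a b c => map_add (mulHom a) b c
    right_distrib := fun a b c => DFunLike.congr_fun (map_add mulHom a b) c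
    zero_mul := fun a => DFunLike.congr_fun (map_zero mulHom) a
    mul_zero := fun a => map_zero (mulHom a)
    one_mul := by
      intro a
      have : mulHom (1 : DrinfeldDouble k G) = LinearMap.id := hom_ext fun h y => by
        simp [one_def, mulHom_elt]
      exact DFunLike.congr_fun this a
    mul_one := by
      intro a
      have : mulHom.flip (1 : DrinfeldDouble k G) = LinearMap.id := hom_ext fun g x => by
        rw [LinearMap.flip_apply]
        simp only [one_def, map_sum, mulHom_elt, mul_one, LinearMap.id_apply]
        rw [Finset.sum_eq_single (x⁻¹ * g * x)]
        · simp [mul_assoc]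
        · intro b _ hb
          rw [if_neg]
          rintro rfl
          simp [mul_assoc] at hb
        · simp
      exact DFunLike.congr_fun this a
    mul_assoc := by
      have h0 : ∀ g x h y l z : G, mulHom (mulHom (elt k g x) (elt k h y)) (elt k l z) =
          mulHom (elt k g x) (mulHom (elt k h y) (elt k l z)) := by
        intro g x h y l z
        simp only [mulHom_elt]
        by_cases h1 : h = y * l * y⁻¹
        · subst h1
          by_cases h2 : g = x * (y * l * y⁻¹) * x⁻¹
          · subst h2
            simp [mulHom_elt, mul_assoc]
          · simp [h2, mulHom_elt]
        · by_cases h2 : g = x * h * x⁻¹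
          · subst h2
            have h3 : ¬ (x * h * x⁻¹ = x * y * l * (x * y)⁻¹) := by
              intro h4
              apply h1
              have h5 : x * h * x⁻¹ = x * (y * l * y⁻¹) * x⁻¹ := h4.trans (by group)
              exact mul_left_cancel (mul_right_cancel h5)
            rw [if_pos rfl, if_neg h1, map_zero, mulHom_elt, if_neg h3]
          · simp [h1, h2]
      have h1 : ∀ g x h y : G, mulHom (mulHom (elt k g x) (elt k h y)) =
          (mulHom (elt k g x)).comp (mulHom (elt k h y)) :=
        fun g x h y => hom_ext fun l z => h0 g x h y l z
      have h2 : ∀ (g x : G) (c : DrinfeldDouble k G), (mulHom.flip c).comp (mulHom (elt k g x)) =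
          (mulHom (elt k g x)).comp (mulHom.flip c) :=
        fun g x c => hom_ext fun h y => DFunLike.congr_fun (h1 g x h y) c
      intro a b c
      have h3 : (mulHom.flip c).comp (mulHom.flip b) = mulHom.flip (mulHom b c) :=
        hom_ext fun g x => DFunLike.congr_fun (h2 g x c) b
      exact DFunLike.congr_fun h3 a }

instance : Algebra k (DrinfeldDouble k G) :=
  Algebra.ofModule (fun r a b => DFunLike.congr_fun (map_smul mulHom r a) b)
    (fun r a b => map_smul (mulHom a) r b)

theorem algHom_ext {B : Type*} [Ring B] [Algebra k B] {f f' : DrinfeldDouble k G →ₐ[k] B}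
    (h : ∀ g x, f (elt k g x) = f' (elt k g x)) : f = f' :=
  AlgHom.toLinearMap_injective (hom_ext h)

/-- A linear map which is unital and multiplicative on basis elements is an algebra morphism. -/
def algHomOfBasis {B : Type*} [Ring B] [Algebra k B] (f : DrinfeldDouble k G →ₗ[k] B)
    (h1 : f 1 = 1)
    (hmul : ∀ g x h y, f (elt k g x * elt k h y) = f (elt k g x) * f (elt k h y)) :
    DrinfeldDouble k G →ₐ[k] B :=
  AlgHom.ofLinearMap f h1 (by
    intro a b
    have h2 : ∀ g x, f.comp (mulHom (elt k g x)) = (LinearMap.mulLeft k (f (elt k g x))).comp f :=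
      fun g x => hom_ext fun h y => hmul g x h y
    have h3 : f.comp (mulHom.flip b) = (LinearMap.mulRight k (f b)).comp f :=
      hom_ext fun g x => DFunLike.congr_fun (h2 g x) b
    exact DFunLike.congr_fun h3 a)

/-- `Δ(g, x) = ∑_{g₁ g₂ = g} (g₁, x) ⊗ (g₂, x)` as a linear map. -/
def comulLin : DrinfeldDouble k G →ₗ[k] DrinfeldDouble k G ⊗[k] DrinfeldDouble k G :=
  (basis k G).constr k fun p =>
    ∑ q : G × G with q.1 * q.2 = p.1, elt k q.1 p.2 ⊗ₜ[k] elt k q.2 p.2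

theorem comulLin_elt (g x : G) : comulLin (elt k g x) =
    ∑ q : G × G with q.1 * q.2 = g, elt k q.1 x ⊗ₜ[k] elt k q.2 x := by
  have h1 : elt k g x = basis k G (g, x) := rfl
  rw [comulLin, h1, Module.Basis.constr_basis]

/-- `ε(g, x) = δ_{g, e}` as a linear map. -/
def counitLin : DrinfeldDouble k G →ₗ[k] k :=
  (basis k G).constr k fun p => if p.1 = 1 then 1 else 0

theorem counitLin_elt (g x : G) : counitLin (elt k g x) = if g = 1 then (1 : k) else 0 := by
  have h1 : elt k g x = basis k G (g, x) := rfl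
  rw [counitLin, h1, Module.Basis.constr_basis]

theorem comulLin_elt' (g x : G) : comulLin (elt k g x) =
    ∑ a : G, elt k a x ⊗ₜ[k] elt k (a⁻¹ * g) x := by
  rw [comulLin_elt]
  symm
  refine Finset.sum_bij (fun a _ => (a, a⁻¹ * g)) ?_ ?_ ?_ ?_
  · simp
  · intro a _ b _ h
    exact (Prod.ext_iff.1 h).1
  · rintro ⟨a, b⟩ h
    have h' : a * b = g := by simpa using h
    exact ⟨a, Finset.mem_univ _, by simp [← h']⟩
  · intro a _
    rfl

/-- The comultiplication of `D(k[G])`. -/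
def comulAlg : DrinfeldDouble k G →ₐ[k] DrinfeldDouble k G ⊗[k] DrinfeldDouble k G :=
  algHomOfBasis comulLin
    (by
      simp only [one_def, map_sum, comulLin_elt', Algebra.TensorProduct.one_def,
        TensorProduct.sum_tmul, TensorProduct.tmul_sum]
      rw [Finset.sum_comm]
      rw [Finset.sum_comm (f := fun (b : G) (a : G) => elt k a (1 : G) ⊗ₜ[k] elt k b (1 : G))]
      refine Finset.sum_congr rfl fun a _ => ?_
      exact Fintype.sum_equiv (Equiv.mulLeft a⁻¹) _ _ fun _ => rfl)
    (by
      intro g x h y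
      rw [elt_mul_elt]
      simp only [comulLin_elt', Finset.sum_mul_sum, Algebra.TensorProduct.tmul_mul_tmul,
        elt_mul_elt]
      have key : ∀ a : G, (∑ b : G, (if a = x * b * x⁻¹ then elt k a (x * y) else 0) ⊗ₜ[k]
          (if a⁻¹ * g = x * (b⁻¹ * h) * x⁻¹ then elt k (a⁻¹ * g) (x * y) else 0)) =
          if g = x * h * x⁻¹ then elt k a (x * y) ⊗ₜ[k] elt k (a⁻¹ * g) (x * y) else 0 := by
        intro a
        rw [Finset.sum_eq_single (x⁻¹ * a * x)]
        · rw [if_pos (by group)]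
          have : (a⁻¹ * g = x * ((x⁻¹ * a * x)⁻¹ * h) * x⁻¹) ↔ g = x * h * x⁻¹ := by
            simp [mul_assoc]
          by_cases hg : g = x * h * x⁻¹
          · rw [if_pos hg, if_pos (this.2 hg)]
          · rw [if_neg hg, if_neg (mt this.1 hg), TensorProduct.tmul_zero]
        · intro b _ hb
          rw [if_neg, TensorProduct.zero_tmul]
          rintro rfl
          apply hb
          group
        · simp
      simp only [key]
      by_cases hg : g = x * h * x⁻¹
      · simp [hg, comulLin_elt']
      · simp [hg])

/-- The counit of `D(k[G])`. -/
def counitAlg : DrinfeldDouble k G →ₐ[k] k :=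
  algHomOfBasis counitLin
    (by simp [one_def, counitLin_elt])
    (by
      intro g x h y
      rw [elt_mul_elt]
      by_cases h1 : h = 1
      · subst h1
        by_cases hg : g = 1 <;> simp [hg, counitLin_elt]
      · by_cases hg : g = x * h * x⁻¹
        · simp [hg, counitLin_elt, h1]
        · simp [hg, counitLin_elt, h1])

theorem comulAlg_elt (g x : G) : comulAlg (elt k g x) =
    ∑ a : G, elt k a x ⊗ₜ[k] elt k (a⁻¹ * g) x := comulLin_elt' g x

theorem counitAlg_elt (g x : G) : counitAlg (elt k g x) = if g = 1 then (1 : k) else 0 :=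
  counitLin_elt g x

/-- The bialgebra structure of the Drinfel'd double. -/
instance : Bialgebra k (DrinfeldDouble k G) :=
  Bialgebra.ofAlgHom comulAlg counitAlg
    (algHom_ext fun g x => by
      simp only [AlgHom.comp_apply, comulAlg_elt, map_sum, Algebra.TensorProduct.map_tmul,
        TensorProduct.sum_tmul, TensorProduct.tmul_sum, AlgHom.id_apply]
      rw [Finset.sum_comm]
      refine Finset.sum_congr rfl fun a _ => ?_
      refine Fintype.sum_equiv (Equiv.mulLeft a⁻¹) _ _ fun b => ?_
      simp [mul_assoc])
    (algHom_ext fun g x => by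
      have h : ∀ a : G, (if a = 1 then (1 : k) else 0) ⊗ₜ[k] elt k (a⁻¹ * g) x =
          if a = 1 then (1 : k) ⊗ₜ[k] elt k (a⁻¹ * g) x else 0 := by
        intro a; split_ifs <;> simp
      simp [comulAlg_elt, counitAlg_elt, h])
    (algHom_ext fun g x => by
      have h : ∀ a : G, elt k a x ⊗ₜ[k] (if a = g then (1 : k) else 0) =
          if a = g then elt k a x ⊗ₜ[k] (1 : k) else 0 := by
        intro a; split_ifs <;> simp
      simp [comulAlg_elt, counitAlg_elt, inv_mul_eq_one, h])

theorem comul_elt (g x : G) : Coalgebra.comul (R := k) (elt k g x) =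
    ∑ q : G × G with q.1 * q.2 = g, elt k q.1 x ⊗ₜ[k] elt k q.2 x := comulLin_elt g x

theorem counit_elt (g x : G) :
    Coalgebra.counit (R := k) (elt k g x) = if g = 1 then (1 : k) else 0 := counitLin_elt g x

end DrinfeldDouble

/-! Equivariant vector bundles over finite sets, that is, vector bundles over the quotient
stacks `[X/Γ]` for finite `Γ`-sets `X` -/

/-- A `Γ`-equivariant vector bundle over a discrete `Γ`-set `X`: a family of finite-dimensional
vector spaces and, for `g • x = y`, a linear map from the fibre at `x` to the fibre at `y`,
compatible with the group law. (Equivalently, a functor from the action groupoid of `X` to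
finite-dimensional vector spaces.) -/
structure EquivariantBundle (k : Type u) [Field k] (Γ : Type v) [Group Γ]
    (X : Type v) [MulAction Γ X] where
  fib : X → Type (max u v)
  [addCommGroup : ∀ x, AddCommGroup (fib x)]
  [module : ∀ x, Module k (fib x)]
  [finiteDimensional : ∀ x, FiniteDimensional k (fib x)]
  act : ∀ (g : Γ) {x y : X}, g • x = y → (fib x →ₗ[k] fib y)
  act_one : ∀ x, act 1 (one_smul Γ x) = LinearMap.id
  act_mul : ∀ (g h : Γ) {x y z : X} (hx : h • x = y) (hy : g • y = z),
    act (g * h) (by rw [mul_smul, hx, hy]) = act g hy ∘ₗ act h hx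

namespace EquivariantBundle

attribute [instance] addCommGroup module finiteDimensional

variable {k : Type u} [Field k] {Γ : Type v} [Group Γ] {X Y : Type v} [MulAction Γ X]
  [MulAction Γ Y]

/-- There is a short exact sequence `0 → L → M → N → 0` of equivariant bundles. -/
def IsSES (L M N : EquivariantBundle k Γ X) : Prop :=
  ∃ (f : ∀ x, L.fib x →ₗ[k] M.fib x) (g : ∀ x, M.fib x →ₗ[k] N.fib x),
    (∀ (γ : Γ) {x y : X} (h : γ • x = y) (v : L.fib x), f y (L.act γ h v) = M.act γ h (f x v)) ∧
    (∀ (γ : Γ) {x y : X} (h : γ • x = y) (v : M.fib x), g y (M.act γ h v) = N.act γ h (g x v)) ∧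
    ∀ x, Function.Injective (f x) ∧ Function.Exact (f x) (g x) ∧ Function.Surjective (g x)

/-- The trivial line bundle. -/
def trivial (k : Type u) [Field k] (Γ : Type v) [Group Γ] (X : Type v) [MulAction Γ X] :
    EquivariantBundle k Γ X where
  fib _ := ULift.{v} k
  act _ _ _ _ := LinearMap.id
  act_one _ := rfl
  act_mul _ _ _ _ _ _ _ := rfl

/-- The tensor product of equivariant bundles. -/
def tensor (M N : EquivariantBundle k Γ X) : EquivariantBundle k Γ X where
  fib x := M.fib x ⊗[k] N.fib x
  act g _ _ h := TensorProduct.map (M.act g h) (N.act g h)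
  act_one x := by rw [M.act_one, N.act_one, TensorProduct.map_id]
  act_mul g h _ _ _ hx hy := by rw [M.act_mul g h hx hy, N.act_mul g h hx hy, TensorProduct.map_comp]

/-- The pullback `f^* M` along an equivariant map. -/
def pullback (f : Y →[Γ] X) (M : EquivariantBundle k Γ X) : EquivariantBundle k Γ Y where
  fib y := M.fib (f y)
  act g x _ h := M.act g (x := f x) (by rw [← map_smul, h])
  act_one y := M.act_one (f y)
  act_mul g h _ _ _ _ _ := M.act_mul g h _ _

theorem pushforward_aux (f : Y →[Γ] X) (g : Γ) {x x' : X} (h : g • x = x')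
    (y : {y : Y // f y = x'}) : f (g⁻¹ • y.1) = x := by
  rw [map_smul, y.2, ← h, inv_smul_smul]

/-- The pushforward `f_* M` along an equivariant map of finite sets: the fibre at `x` is the
(finite) direct sum of the fibres of `M` over the points of `f⁻¹(x)`. -/
def pushforward [Finite Y] (f : Y →[Γ] X) (M : EquivariantBundle k Γ Y) :
    EquivariantBundle k Γ X where
  fib x := ∀ y : {y : Y // f y = x}, M.fib y.1
  act g _ _ h :=
    LinearMap.pi fun y =>
      M.act g (smul_inv_smul g y.1) ∘ₗ
        LinearMap.proj (⟨g⁻¹ • y.1, pushforward_aux f g h y⟩ : {y : Y // f y = _})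
  act_one x := by
    ext v y
    have key : ∀ (z : {y : Y // f y = x}) (hz : (1 : Γ) • z.1 = y.1), M.act 1 hz (v z) = v y := by
      intro z hz
      have : z = y := Subtype.ext ((one_smul Γ z.1).symm.trans hz)
      subst this
      exact DFunLike.congr_fun (M.act_one z.1) (v z)
    exact key ⟨(1 : Γ)⁻¹ • y.1, _⟩ _
  act_mul g h x x' x'' hx hy := by
    ext v y
    have key : ∀ (z z' : {y : Y // f y = x}) (w : Y) (hz : (g * h) • z.1 = y.1)
        (hw : h • z'.1 = w) (hy : g • w = y.1),
        M.act (g * h) hz (v z) = M.act g hy (M.act h hw (v z')) := by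
      intro z z' w hz hw hy
      have : z = z' := by
        apply Subtype.ext
        apply MulAction.injective (g * h)
        change (g * h) • z.1 = (g * h) • z'.1
        rw [hz, mul_smul, hw, hy]
      subst this
      exact DFunLike.congr_fun (M.act_mul g h hw hy) (v z)
    exact key ⟨(g * h)⁻¹ • y.1, _⟩ ⟨h⁻¹ • g⁻¹ • y.1, _⟩ (g⁻¹ • y.1) _ _ _

theorem isSES_tensor_left (L M N D : EquivariantBundle k Γ X) (h : IsSES L M N) :
    IsSES (tensor L D) (tensor M D) (tensor N D) := by
  obtain ⟨f, g, hf, hg, he⟩ := h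
  refine ⟨fun x => (f x).rTensor (D.fib x), fun x => (g x).rTensor (D.fib x),
    fun γ x y h v => ?_, fun γ x y h v => ?_, fun x => ⟨?_, ?_, ?_⟩⟩
  · have : (f y).rTensor (D.fib y) ∘ₗ TensorProduct.map (L.act γ h) (D.act γ h) =
        TensorProduct.map (M.act γ h) (D.act γ h) ∘ₗ (f x).rTensor (D.fib x) :=
      TensorProduct.ext' fun v w => by simp [hf]
    exact DFunLike.congr_fun this v
  · have : (g y).rTensor (D.fib y) ∘ₗ TensorProduct.map (M.act γ h) (D.act γ h) =
        TensorProduct.map (N.act γ h) (D.act γ h) ∘ₗ (g x).rTensor (D.fib x) :=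
      TensorProduct.ext' fun v w => by simp [hg]
    exact DFunLike.congr_fun this v
  · exact Module.Flat.rTensor_preserves_injective_linearMap _ (he x).1
  · exact rTensor_exact _ (he x).2.1 (he x).2.2
  · exact LinearMap.rTensor_surjective _ (he x).2.2

theorem isSES_tensor_right (L M N D : EquivariantBundle k Γ X) (h : IsSES L M N) :
    IsSES (tensor D L) (tensor D M) (tensor D N) := by
  obtain ⟨f, g, hf, hg, he⟩ := h
  refine ⟨fun x => (f x).lTensor (D.fib x), fun x => (g x).lTensor (D.fib x),
    fun γ x y h v => ?_, fun γ x y h v => ?_, fun x => ⟨?_, ?_, ?_⟩⟩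
  · have : (f y).lTensor (D.fib y) ∘ₗ TensorProduct.map (D.act γ h) (L.act γ h) =
        TensorProduct.map (D.act γ h) (M.act γ h) ∘ₗ (f x).lTensor (D.fib x) :=
      TensorProduct.ext' fun v w => by simp [hf]
    exact DFunLike.congr_fun this v
  · have : (g y).lTensor (D.fib y) ∘ₗ TensorProduct.map (D.act γ h) (M.act γ h) =
        TensorProduct.map (D.act γ h) (N.act γ h) ∘ₗ (g x).lTensor (D.fib x) :=
      TensorProduct.ext' fun v w => by simp [hg]
    exact DFunLike.congr_fun this v
  · exact Module.Flat.lTensor_preserves_injective_linearMap _ (he x).1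
  · exact lTensor_exact _ (he x).2.1 (he x).2.2
  · exact LinearMap.lTensor_surjective _ (he x).2.2

theorem isSES_pullback (p : Y →[Γ] X) (L M N : EquivariantBundle k Γ X) (h : IsSES L M N) :
    IsSES (pullback p L) (pullback p M) (pullback p N) := by
  obtain ⟨f, g, hf, hg, he⟩ := h
  exact ⟨fun y => f (p y), fun y => g (p y), fun γ _ _ h v => hf γ _ v, fun γ _ _ h v => hg γ _ v,
    fun y => he (p y)⟩

theorem isSES_pushforward [Finite Y] (p : Y →[Γ] X) (L M N : EquivariantBundle k Γ Y)
    (h : IsSES L M N) : IsSES (pushforward p L) (pushforward p M) (pushforward p N) := by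
  obtain ⟨f, g, hf, hg, he⟩ := h
  refine ⟨fun x => LinearMap.pi fun y => f y.1 ∘ₗ LinearMap.proj y,
    fun x => LinearMap.pi fun y => g y.1 ∘ₗ LinearMap.proj y,
    fun γ _ _ h v => ?_, fun γ _ _ h v => ?_, fun x => ⟨?_, ?_, ?_⟩⟩
  · funext y
    exact hf γ _ _
  · funext y
    exact hg γ _ _
  · intro v w hvw
    funext y
    exact (he y.1).1 (congrFun hvw y)
  · intro v
    constructor
    · intro hv
      have h1 : ∀ y : {y : Y // p y = x}, ∃ w, f y.1 w = v y :=
        fun y => ((he y.1).2.1 (v y)).1 (congrFun hv y)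
      choose w hw using h1
      exact ⟨w, funext hw⟩
    · rintro ⟨w, rfl⟩
      funext y
      exact ((he y.1).2.1 _).2 ⟨w y, rfl⟩
  · intro v
    choose w hw using fun y : {y : Y // p y = x} => (he y.1).2.2 (v y)
    exact ⟨w, funext hw⟩

end EquivariantBundle

/-- `K([X/Γ]) = K_Γ(X)`: the Grothendieck group of equivariant vector bundles. -/
abbrev EquivariantK (k : Type u) [Field k] (Γ : Type v) [Group Γ] (X : Type v) [MulAction Γ X] :
    Type _ :=
  GrothendieckK (EquivariantBundle k Γ X) EquivariantBundle.IsSES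

/-! The full orbifold `K`-theory of `[pt/G]`

The inertia stack of `[pt/G]` is `[G/G]`, where `G` acts on `G = ∐_{m ∈ G} pt^m` by conjugation,
and the stack of pairs `(m₁, m₂)` is `[G × G/G]`, for simultaneous conjugation. -/

namespace PointStack

variable {G : Type v} [Group G]

/-- The evaluation map `(m₁, m₂) ↦ m₁`. -/
def e₁ : (G × G) →[ConjAct G] G where
  toFun := Prod.fst
  map_smul' _ _ := rfl

/-- The evaluation map `(m₁, m₂) ↦ m₂`. -/
def e₂ : (G × G) →[ConjAct G] G where
  toFun := Prod.snd
  map_smul' _ _ := rfl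

/-- The evaluation map `(m₁, m₂) ↦ m₃⁻¹ = m₁ m₂`, where `m₁ m₂ m₃ = 1`. -/
def e₃ : (G × G) →[ConjAct G] G where
  toFun m := m.1 * m.2
  map_smul' g m := (smul_mul' g m.1 m.2).symm

/-- The inclusion of the untwisted sector. -/
def untwisted : PUnit.{v + 1} →[ConjAct G] G where
  toFun _ := 1
  map_smul' g _ := (smul_one g).symm

end PointStack

/-- `K_full([pt/G])`, the `K`-theory of the inertia stack of `[pt/G]`. -/
def KFull (k : Type u) [Field k] (G : Type v) [Group G] : Type (max (u + 1) (v + 1)) :=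
  EquivariantK k (ConjAct G) G

namespace KFull

variable {k : Type u} [Field k] {G : Type v} [Group G]

instance : AddCommGroup (KFull k G) := inferInstanceAs (AddCommGroup (EquivariantK k (ConjAct G) G))

/-- The class of a vector bundle on the inertia stack. -/
def cls (E : EquivariantBundle k (ConjAct G) G) : KFull k G :=
  GrothendieckK.cls EquivariantBundle.IsSES E

variable [Finite G]

/-- The stringy push-pull product of bundles, `(E, F) ↦ e₃_* (e₁^* E ⊗ e₂^* F)`. The tangent
bundle of a point is zero, so the obstruction bundle is zero and its Euler class is `1`. -/
def stringyProduct (E F : EquivariantBundle k (ConjAct G) G) : EquivariantBundle k (ConjAct G) G :=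
  EquivariantBundle.pushforward PointStack.e₃
    (EquivariantBundle.tensor (EquivariantBundle.pullback PointStack.e₁ E)
      (EquivariantBundle.pullback PointStack.e₂ F))

/-- The product of `K_full([pt/G])`, induced by the push-pull product of bundles. -/
def mulHom : KFull k G →+ KFull k G →+ KFull k G :=
  GrothendieckK.lift₂ stringyProduct
    (fun _ _ _ _ h => EquivariantBundle.isSES_pushforward _ _ _ _
      (EquivariantBundle.isSES_tensor_left _ _ _ _ (EquivariantBundle.isSES_pullback _ _ _ _ h)))
    (fun _ _ _ _ h => EquivariantBundle.isSES_pushforward _ _ _ _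
      (EquivariantBundle.isSES_tensor_right _ _ _ _ (EquivariantBundle.isSES_pullback _ _ _ _ h)))

instance : NonUnitalNonAssocRing (KFull k G) :=
  { (inferInstance : AddCommGroup (KFull k G)) with
    mul := fun x y => mulHom x y
    left_distrib := fun x y z => map_add (mulHom x) y z
    right_distrib := fun x y z => DFunLike.congr_fun (map_add mulHom x y) z
    zero_mul := fun x => DFunLike.congr_fun (map_zero mulHom) x
    mul_zero := fun x => map_zero (mulHom x) }

/-- The unit: the trivial line bundle on the untwisted sector. -/
instance : One (KFull k G) :=
  ⟨cls (EquivariantBundle.pushforward PointStack.untwisted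
    (EquivariantBundle.trivial k (ConjAct G) PUnit.{v + 1}))⟩

theorem cls_mul_cls (E F : EquivariantBundle k (ConjAct G) G) :
    cls E * cls F = cls (stringyProduct E F) := GrothendieckK.lift₂_cls _ _ _ _ _

end KFull

/-- For `g : G`, the fibre at `g` of a vector bundle on the inertia stack is a representation of
the centralizer `Z(g)`. -/
def EquivariantBundle.sectorRep {k : Type u} [Field k] {G : Type v} [Group G]
    (E : EquivariantBundle k (ConjAct G) G) (g : G) :
    Representation k (Subgroup.centralizer ({g} : Set G)) (E.fib g) :=
  have h : ∀ z : Subgroup.centralizer ({g} : Set G), ConjAct.toConjAct (z : G) • g = g := by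
    intro z
    rw [ConjAct.toConjAct_smul, Subgroup.mem_centralizer_singleton_iff.1 z.2, mul_inv_cancel_right]
  { toFun := fun z => E.act (ConjAct.toConjAct (z : G)) (h z)
    map_one' := E.act_one g
    map_mul' := fun z z' => E.act_mul _ _ (h z') (h z) }

end

noncomputable section

namespace EquivariantBundle

variable {k : Type u} [Field k] {Γ : Type v} [Group Γ] {X : Type v} [MulAction Γ X]

/-- The class of an equivariant bundle. -/
abbrev cls (E : EquivariantBundle k Γ X) : EquivariantK k Γ X :=
  GrothendieckK.cls EquivariantBundle.IsSES E

theorem act_act (E : EquivariantBundle k Γ X) {a b c : Γ} (hc : a * b = c) {x y z : X}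
    (h : b • x = y) (h' : a • y = z) (h'' : c • x = z) (v : E.fib x) :
    E.act a h' (E.act b h v) = E.act c h'' v := by
  subst hc
  rw [E.act_mul a b h h']
  rfl

theorem act_eq_self (E : EquivariantBundle k Γ X) {a : Γ} (ha : a = 1) {x : X}
    (h : a • x = x) (v : E.fib x) : E.act a h v = v := by
  subst ha
  exact DFunLike.congr_fun (E.act_one x) v

/-- A fibrewise section transported along an equality of group elements acting. -/
theorem act_section_congr (E : EquivariantBundle k Γ X) (s : ∀ x, E.fib x) {a b : Γ} (hab : a = b)
    {x x' y : X} (hx : x = x') (h : a • x = y) (h' : b • x' = y) :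
    E.act a h (s x) = E.act b h' (s x') := by
  subst hab hx
  rfl

theorem cls_zero {Z : EquivariantBundle k Γ X} (hZ : ∀ x, Subsingleton (Z.fib x)) :
    cls Z = 0 := by
  have h : IsSES Z Z Z := ⟨fun _ => LinearMap.id, fun _ => 0, by simp, by simp,
    fun z => ⟨fun _ _ _ => (hZ z).elim _ _,
      fun x => ⟨fun _ => ⟨x, rfl⟩, fun _ => rfl⟩, fun x => ⟨0, (hZ z).elim _ _⟩⟩⟩
  simpa using GrothendieckK.cls_eq_add h

theorem cls_congr {M N : EquivariantBundle k Γ X} (e : ∀ x, M.fib x ≃ₗ[k] N.fib x)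
    (he : ∀ (γ : Γ) {x y : X} (h : γ • x = y) (v : M.fib x),
      e y (M.act γ h v) = N.act γ h (e x v)) : cls M = cls N := by
  let Z : EquivariantBundle k Γ X :=
    { fib := fun _ => PUnit
      act := fun _ _ _ _ => 0
      act_one := fun _ => rfl
      act_mul := fun _ _ _ _ _ _ _ => rfl }
  have hZ : cls Z = 0 := cls_zero fun _ => inferInstanceAs (Subsingleton PUnit)
  have h : IsSES M N Z := ⟨fun x => (e x).toLinearMap, fun _ => 0, he, by simp, fun x =>
    ⟨(e x).injective, fun v => ⟨fun _ => ⟨(e x).symm v, by simp⟩, fun _ => rfl⟩,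
      fun v => ⟨0, rfl⟩⟩⟩
  have := GrothendieckK.cls_eq_add h
  rw [show GrothendieckK.cls IsSES Z = 0 from hZ, add_zero] at this
  exact this.symm

end EquivariantBundle

/-! Equivariant bundles and modules over the Drinfel'd double -/

section DoubleModule

variable {k : Type u} [Field k] {G : Type v} [Group G] [Fintype G] [DecidableEq G]

namespace EquivariantBundle

open DrinfeldDouble

/-- The action of a basis element of `D(k[G])` on the total space of a bundle: translate the
section, then restrict it to one fibre. -/
def doubleAct (E : EquivariantBundle k (ConjAct G) G) (q x : G) : Module.End k (∀ g, E.fib g) :=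
  LinearMap.pi fun y => if y = q then
    E.act (ConjAct.toConjAct x) (smul_inv_smul (ConjAct.toConjAct x) y) ∘ₗ
      LinearMap.proj ((ConjAct.toConjAct x)⁻¹ • y) else 0

theorem doubleAct_apply (E : EquivariantBundle k (ConjAct G) G) (q x : G) (v : ∀ g, E.fib g)
    (y : G) : E.doubleAct q x v y = if y = q then
      E.act (ConjAct.toConjAct x) (smul_inv_smul (ConjAct.toConjAct x) y)
        (v ((ConjAct.toConjAct x)⁻¹ • y)) else 0 := by
  unfold doubleAct
  rw [LinearMap.pi_apply]
  split_ifs <;> rfl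

/-- The linear extension of `doubleAct`. -/
def doubleLin (E : EquivariantBundle k (ConjAct G) G) :
    DrinfeldDouble k G →ₗ[k] Module.End k (∀ g, E.fib g) :=
  (basis k G).constr k fun p => E.doubleAct p.1 p.2

theorem doubleLin_elt (E : EquivariantBundle k (ConjAct G) G) (q x : G) :
    E.doubleLin (elt k q x) = E.doubleAct q x := by
  have h1 : elt k q x = basis k G (q, x) := rfl
  rw [doubleLin, h1, Module.Basis.constr_basis]

theorem doubleAct_mul (E : EquivariantBundle k (ConjAct G) G) (g x h y : G) :
    E.doubleAct g x * E.doubleAct h y = if g = x * h * x⁻¹ then E.doubleAct g (x * y) else 0 := by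
  refine LinearMap.ext fun v => funext fun z => ?_
  rw [Module.End.mul_apply, doubleAct_apply]
  by_cases hz : z = g
  · subst hz
    rw [if_pos rfl, doubleAct_apply]
    have hiff : (ConjAct.toConjAct x)⁻¹ • z = h ↔ z = x * h * x⁻¹ := by
      rw [inv_smul_eq_iff, ConjAct.toConjAct_smul]
    by_cases hh : z = x * h * x⁻¹
    · rw [if_pos (hiff.2 hh), if_pos hh, doubleAct_apply, if_pos rfl,
        E.act_act rfl _ _ (by rw [mul_smul, smul_inv_smul, smul_inv_smul])]
      exact E.act_section_congr v rfl (by rw [← mul_smul, ← mul_inv_rev]; rfl) _ _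
    · rw [if_neg (mt hiff.1 hh), if_neg hh, map_zero]
      rfl
  · rw [if_neg hz]
    split_ifs
    · rw [doubleAct_apply, if_neg hz]
    · rfl

/-- The module over `D(k[G])` of an equivariant bundle: the direct sum of the fibres. -/
def toModule (E : EquivariantBundle k (ConjAct G) G) : FDModule k (DrinfeldDouble k G) where
  V := ∀ g, E.fib g
  ρ := algHomOfBasis E.doubleLin
    (by
      refine LinearMap.ext fun v => funext fun y => ?_
      rw [one_def, map_sum, LinearMap.sum_apply, Finset.sum_apply, Finset.sum_eq_single y]
      · rw [doubleLin_elt, doubleAct_apply, if_pos rfl]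
        refine (E.act_section_congr v (map_one _) (by simp) _ (one_smul _ y)).trans ?_
        exact DFunLike.congr_fun (E.act_one y) _
      · intro b _ hb
        rw [doubleLin_elt, doubleAct_apply, if_neg hb.symm]
      · simp)
    (by
      intro g x h y
      rw [elt_mul_elt, doubleLin_elt, doubleLin_elt, doubleAct_mul]
      split_ifs
      · rw [doubleLin_elt]
      · rw [map_zero])

theorem toModule_rho_elt (E : EquivariantBundle k (ConjAct G) G) (q x : G) :
    E.toModule.ρ (elt k q x) = E.doubleAct q x := E.doubleLin_elt q x

theorem toModule_elt (E : EquivariantBundle k (ConjAct G) G) (q x : G) (v : ∀ g, E.fib g)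
    (y : G) : (E.toModule.ρ (elt k q x) : Module.End k (∀ g, E.fib g)) v y = if y = q then
      E.act (ConjAct.toConjAct x) (smul_inv_smul (ConjAct.toConjAct x) y)
        (v ((ConjAct.toConjAct x)⁻¹ • y)) else 0 := by
  rw [← doubleAct_apply, ← doubleLin_elt]
  rfl

end EquivariantBundle

namespace FDModule

open DrinfeldDouble

/-- A linear map commuting with the basis elements of `D(k[G])` is a module morphism. -/
theorem intertwines_of_elt {M N : FDModule k (DrinfeldDouble k G)} (f : M.V →ₗ[k] N.V)
    (h : ∀ q x v, f (M.ρ (elt k q x) v) = N.ρ (elt k q x) (f v)) (a : DrinfeldDouble k G)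
    (v : M.V) : f (M.ρ a v) = N.ρ a (f v) := by
  have : (LinearMap.compRight k f).comp M.ρ.toLinearMap =
      (LinearMap.lcomp k N.V f).comp N.ρ.toLinearMap :=
    hom_ext fun q x => LinearMap.ext fun v => h q x v
  exact DFunLike.congr_fun (DFunLike.congr_fun this a) v

end FDModule

namespace EquivariantBundle

open DrinfeldDouble

theorem isSES_toModule (L M N : EquivariantBundle k (ConjAct G) G) (h : IsSES L M N) :
    FDModule.IsSES L.toModule M.toModule N.toModule := by
  obtain ⟨f, g, hf, hg, he⟩ := h
  have hpi : ∀ {E F : EquivariantBundle k (ConjAct G) G} (f : ∀ x, E.fib x →ₗ[k] F.fib x)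
      (_ : ∀ (γ : ConjAct G) {x y : G} (h : γ • x = y) (v : E.fib x),
        f y (E.act γ h v) = F.act γ h (f x v)) (a : DrinfeldDouble k G) (v : E.toModule.V),
      LinearMap.piMap f (E.toModule.ρ a v) = F.toModule.ρ a (LinearMap.piMap f v) := by
    intro E F f hf
    refine FDModule.intertwines_of_elt (M := E.toModule) (N := F.toModule) (LinearMap.piMap f)
      fun q x v => funext fun y => ?_
    refine Eq.trans ?_ (F.toModule_elt q x _ y).symm
    refine (congrArg (f y) (E.toModule_elt q x v y)).trans ?_
    split_ifs
    · exact hf _ _ _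
    · exact map_zero _
  refine ⟨LinearMap.piMap f, LinearMap.piMap g, hpi f hf, hpi g hg, ?_, ?_, ?_⟩
  · exact fun v w hvw => funext fun y => (he y).1 (congrFun hvw y)
  · intro v
    constructor
    · intro hv
      choose w hw using fun y => ((he y).2.1 (v y)).1 (congrFun hv y)
      exact ⟨w, funext hw⟩
    · rintro ⟨w, rfl⟩
      exact funext fun y => ((he y).2.1 _).2 ⟨w y, rfl⟩
  · intro v
    choose w hw using fun y => (he y).2.2 (v y)
    exact ⟨w, funext hw⟩

end EquivariantBundle

end DoubleModule

end

noncomputable section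

theorem ConjAct.eq_conj_of_smul {G : Type*} [Group G] {γ : ConjAct G} {x y : G} (h : γ • x = y) :
    y = ConjAct.ofConjAct γ * x * (ConjAct.ofConjAct γ)⁻¹ := by
  rw [← h, ConjAct.smul_def]

section ModuleBundle

variable {k : Type u} [Field k] {G : Type v} [Group G] [Fintype G] [DecidableEq G]

namespace FDModule

open DrinfeldDouble

theorem elt_one_elt (M : FDModule k (DrinfeldDouble k G)) (p q x : G) (v : M.V) :
    M.ρ (elt k p 1) (M.ρ (elt k q x) v) = if p = q then M.ρ (elt k q x) v else 0 := by
  rw [← Module.End.mul_apply, ← map_mul, elt_mul_elt]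
  by_cases h : p = q
  · subst h
    simp
  · simp [h]

theorem elt_elt_one (M : FDModule k (DrinfeldDouble k G)) {p q x : G} (h : p = x * q * x⁻¹)
    (v : M.V) : M.ρ (elt k p x) (M.ρ (elt k q 1) v) = M.ρ (elt k p x) v := by
  rw [← Module.End.mul_apply, ← map_mul, elt_mul_elt, if_pos h, mul_one]

theorem sum_elt_one (M : FDModule k (DrinfeldDouble k G)) (v : M.V) :
    ∑ g, M.ρ (elt k g 1) v = v := by
  rw [← LinearMap.sum_apply, ← map_sum, ← one_def, map_one, Module.End.one_apply]

/-- The homogeneous component of a module over `D(k[G])`. -/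
def component (M : FDModule k (DrinfeldDouble k G)) (g : G) : Submodule k M.V :=
  LinearMap.range (M.ρ (elt k g 1))

theorem elt_mem_component (M : FDModule k (DrinfeldDouble k G)) (g x : G) (v : M.V) :
    M.ρ (elt k g x) v ∈ M.component g :=
  ⟨M.ρ (elt k g x) v, by rw [elt_one_elt, if_pos rfl]⟩

theorem elt_one_of_mem {M : FDModule k (DrinfeldDouble k G)} {g : G} {v : M.V}
    (h : v ∈ M.component g) : M.ρ (elt k g 1) v = v := by
  obtain ⟨w, rfl⟩ := h
  rw [elt_one_elt, if_pos rfl]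

/-- The equivariant bundle of homogeneous components of a module over `D(k[G])`. -/
def toBundle (M : FDModule k (DrinfeldDouble k G)) : EquivariantBundle k (ConjAct G) G where
  fib g := M.component g
  act γ _ y _ := (M.ρ (elt k y (ConjAct.ofConjAct γ))).restrict
    fun v _ => M.elt_mem_component y (ConjAct.ofConjAct γ) v
  act_one x := LinearMap.ext fun v => Subtype.ext (elt_one_of_mem v.2)
  act_mul g h x y z _ hy := LinearMap.ext fun v => Subtype.ext (by
    change M.ρ (elt k z (ConjAct.ofConjAct (g * h))) v.1 =
      M.ρ (elt k z (ConjAct.ofConjAct g)) (M.ρ (elt k y (ConjAct.ofConjAct h)) v.1)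
    rw [← Module.End.mul_apply, ← map_mul, elt_mul_elt, if_pos (ConjAct.eq_conj_of_smul hy)]
    rfl)

theorem isSES_toBundle (L M N : FDModule k (DrinfeldDouble k G)) (h : IsSES L M N) :
    EquivariantBundle.IsSES L.toBundle M.toBundle N.toBundle := by
  obtain ⟨f, g, hf, hg, hi, he, hs⟩ := h
  have hmem : ∀ {E F : FDModule k (DrinfeldDouble k G)} {f : E.V →ₗ[k] F.V}
      (_ : ∀ a v, f (E.ρ a v) = F.ρ a (f v)) (x : G), ∀ v ∈ E.component x, f v ∈ F.component x := by
    rintro E F f hf x _ ⟨v, rfl⟩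
    exact ⟨f v, (hf _ _).symm⟩
  refine ⟨fun x => f.restrict (hmem hf x), fun x => g.restrict (hmem hg x),
    fun γ x y h v => Subtype.ext (hf _ _), fun γ x y h v => Subtype.ext (hg _ _),
    fun x => ⟨?_, ?_, ?_⟩⟩
  · exact fun v w hvw => Subtype.ext (hi (congrArg Subtype.val hvw))
  · intro v
    constructor
    · intro hv
      obtain ⟨w, hw⟩ := (he v.1).1 (congrArg Subtype.val hv)
      refine ⟨⟨L.ρ (elt k x 1) w, L.elt_mem_component x 1 w⟩, Subtype.ext ?_⟩
      exact (hf _ _).trans ((congrArg _ hw).trans (elt_one_of_mem v.2))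
    · rintro ⟨w, rfl⟩
      exact Subtype.ext ((he _).2 ⟨w.1, rfl⟩)
  · intro v
    obtain ⟨w, hw⟩ := hs v.1
    refine ⟨⟨M.ρ (elt k x 1) w, M.elt_mem_component x 1 w⟩, Subtype.ext ?_⟩
    exact (hg _ _).trans ((congrArg _ hw).trans (elt_one_of_mem v.2))

theorem cls_toModule_toBundle (M : FDModule k (DrinfeldDouble k G)) :
    RepRing.cls M.toBundle.toModule = RepRing.cls M := by
  let f : M.V →ₗ[k] (∀ g, M.component g) :=
    LinearMap.pi fun g => (M.ρ (elt k g 1)).rangeRestrict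
  have hf : Function.Bijective f := by
    constructor
    · rw [injective_iff_map_eq_zero]
      intro v hv
      rw [← M.sum_elt_one v]
      exact Finset.sum_eq_zero fun g _ => congrArg Subtype.val (congrFun hv g)
    · intro v
      refine ⟨∑ g, (v g).1, funext fun h => Subtype.ext ?_⟩
      change M.ρ (elt k h 1) (∑ g, (v g).1) = (v h).1
      rw [map_sum, Finset.sum_eq_single h]
      · exact elt_one_of_mem (v h).2
      · intro g _ hg
        rw [← elt_one_of_mem (v g).2, elt_one_elt, if_neg hg.symm]
      · simp
  symm
  refine FDModule.cls_congr (N := M.toBundle.toModule) (LinearEquiv.ofBijective f hf) ?_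
  refine intertwines_of_elt (N := M.toBundle.toModule) f fun q x v => funext fun y => ?_
  refine Eq.trans (Subtype.ext ?_) (M.toBundle.toModule_elt q x _ y).symm
  change M.ρ (elt k y 1) (M.ρ (elt k q x) v) = _
  rw [elt_one_elt]
  by_cases h : y = q
  · subst h
    rw [if_pos rfl, if_pos rfl]
    exact (M.elt_elt_one (ConjAct.eq_conj_of_smul (smul_inv_smul (ConjAct.toConjAct x) y)) v).symm
  · rw [if_neg h, if_neg h]
    rfl

end FDModule

namespace EquivariantBundle

open DrinfeldDouble

theorem cls_toBundle_toModule (E : EquivariantBundle k (ConjAct G) G) :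
    cls E.toModule.toBundle = cls E := by
  have happ : ∀ (x : G) (v : E.toModule.component x) (y : G), (v.1 : ∀ g, E.fib g) y =
      if y = x then (v.1 : ∀ g, E.fib g) y else 0 := by
    rintro x ⟨_, w, rfl⟩ y
    by_cases h : y = x
    · exact (if_pos h).symm
    · exact ((E.toModule_elt x 1 w y).trans (if_neg h)).trans (if_neg h).symm
  let f : ∀ x, E.toModule.component x →ₗ[k] E.fib x := fun x =>
    (LinearMap.proj x : (∀ g, E.fib g) →ₗ[k] E.fib x) ∘ₗ (E.toModule.component x).subtype
  have hf : ∀ x, Function.Bijective (f x) := by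
    intro x
    constructor
    · rw [injective_iff_map_eq_zero]
      intro v hv
      refine Subtype.ext (funext fun y => (happ x v y).trans ?_)
      split_ifs with h
      · subst h
        exact hv
      · rfl
    · intro w
      refine ⟨⟨E.toModule.ρ (elt k x 1) (Pi.single x w : ∀ g, E.fib g),
        E.toModule.elt_mem_component x 1 _⟩, ?_⟩
      refine (E.toModule_elt x 1 (Pi.single x w) x).trans ?_
      rw [if_pos rfl]
      refine (E.act_section_congr (Pi.single x w) (map_one _) (by simp) _ (one_smul _ x)).trans ?_
      rw [Pi.single_eq_same]
      exact E.act_eq_self rfl _ w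
  refine cls_congr (M := E.toModule.toBundle) (fun x => LinearEquiv.ofBijective (f x) (hf x)) ?_
  intro γ x y h v
  refine (E.toModule_elt y (ConjAct.ofConjAct γ) v.1 y).trans ?_
  rw [if_pos rfl]
  exact E.act_section_congr v.1 (ConjAct.toConjAct_ofConjAct γ)
    (by rw [ConjAct.toConjAct_ofConjAct, ← h, inv_smul_smul]) _ h

end EquivariantBundle

namespace EquivariantK

/-- `K([G/G])` is additively isomorphic to the representation group of `D(k[G])`. -/
def addEquivRepRing : EquivariantK k (ConjAct G) G ≃+ RepRing k (DrinfeldDouble k G) :=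
  AddMonoidHom.toAddEquiv
    (GrothendieckK.lift (fun E => RepRing.cls (EquivariantBundle.toModule E))
      fun _ _ _ h => GrothendieckK.cls_eq_add (EquivariantBundle.isSES_toModule _ _ _ h))
    (GrothendieckK.lift (fun M => EquivariantBundle.cls (FDModule.toBundle M))
      fun _ _ _ h => GrothendieckK.cls_eq_add (FDModule.isSES_toBundle _ _ _ h))
    (GrothendieckK.hom_ext fun E => by
      rw [AddMonoidHom.comp_apply, GrothendieckK.lift_cls, GrothendieckK.lift_cls]
      exact E.cls_toBundle_toModule)
    (GrothendieckK.hom_ext fun M => by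
      rw [AddMonoidHom.comp_apply, GrothendieckK.lift_cls, GrothendieckK.lift_cls]
      exact M.cls_toModule_toBundle)

theorem addEquivRepRing_cls (E : EquivariantBundle k (ConjAct G) G) :
    addEquivRepRing (EquivariantBundle.cls E) = RepRing.cls E.toModule :=
  GrothendieckK.lift_cls (fun E => RepRing.cls (EquivariantBundle.toModule E))
    (fun _ _ _ h => GrothendieckK.cls_eq_add (EquivariantBundle.isSES_toModule _ _ _ h)) E

end EquivariantK

end ModuleBundle

end

noncomputable section

section TensorPi

variable {k : Type*} [Field k] {G : Type*} [Mul G]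
  (V W : G → Type*) [∀ g, AddCommGroup (V g)] [∀ g, Module k (V g)]
  [∀ g, AddCommGroup (W g)] [∀ g, Module k (W g)]

/-- The canonical map from the tensor product of two products to the convolution product of the
families. -/
def tensorPiMap : (∀ g, V g) ⊗[k] (∀ g, W g) →ₗ[k]
    ∀ (g : G) (p : {p : G × G // p.1 * p.2 = g}), V p.1.1 ⊗[k] W p.1.2 :=
  LinearMap.pi fun _ => LinearMap.pi fun p =>
    TensorProduct.map (LinearMap.proj p.1.1) (LinearMap.proj p.1.2)

variable {V W}

theorem tensorPiMap_apply (t : (∀ g, V g) ⊗[k] (∀ g, W g)) (g : G)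
    (p : {p : G × G // p.1 * p.2 = g}) : tensorPiMap (k := k) V W t g p =
      TensorProduct.map (LinearMap.proj p.1.1) (LinearMap.proj p.1.2) t := rfl

theorem tensorPiMap_tmul (v : ∀ g, V g) (w : ∀ g, W g) (g : G)
    (p : {p : G × G // p.1 * p.2 = g}) :
    tensorPiMap (k := k) V W (v ⊗ₜ w) g p = v p.1.1 ⊗ₜ w p.1.2 := rfl

theorem tensorPiMap_bijective [Finite G] : Function.Bijective (tensorPiMap (k := k) V W) := by
  classical
  have := Fintype.ofFinite G
  let s : (∀ (g : G) (p : {p : G × G // p.1 * p.2 = g}), V p.1.1 ⊗[k] W p.1.2) →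
      (∀ g, V g) ⊗[k] (∀ g, W g) := fun w =>
    ∑ p : G × G, TensorProduct.map (LinearMap.single k V p.1) (LinearMap.single k W p.2)
      (w (p.1 * p.2) ⟨p, rfl⟩)
  constructor
  · refine Function.LeftInverse.injective (g := s) fun x => ?_
    induction x with
    | zero => simp [s]
    | add x y hx hy =>
      conv_rhs => rw [← hx, ← hy]
      simp only [s, map_add, Pi.add_apply, Finset.sum_add_distrib]
    | tmul v w =>
      simp only [s, tensorPiMap_tmul, TensorProduct.map_tmul, LinearMap.coe_single]
      conv_rhs => rw [← Finset.univ_sum_single v, ← Finset.univ_sum_single w]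
      rw [TensorProduct.sum_tmul, Fintype.sum_prod_type]
      exact Finset.sum_congr rfl fun i _ => by rw [TensorProduct.tmul_sum]
  · refine Function.RightInverse.surjective (g := s) fun w => ?_
    funext g p
    obtain ⟨p, rfl⟩ := p
    simp only [s, tensorPiMap_apply, map_sum]
    rw [Finset.sum_eq_single p]
    · rw [← LinearMap.comp_apply, ← TensorProduct.map_comp, LinearMap.proj_comp_single_same,
        LinearMap.proj_comp_single_same, TensorProduct.map_id, LinearMap.id_apply]
    · intro q _ hq
      rw [← LinearMap.comp_apply, ← TensorProduct.map_comp]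
      by_cases h1 : q.1 = p.1
      · have h2 : q.2 ≠ p.2 := fun h2 => hq (Prod.ext h1 h2)
        rw [LinearMap.proj_comp_single_ne k W _ _ h2.symm, TensorProduct.map_zero_right,
          LinearMap.zero_apply]
      · rw [LinearMap.proj_comp_single_ne k V _ _ (Ne.symm h1), TensorProduct.map_zero_left,
          LinearMap.zero_apply]
    · simp

end TensorPi

section Multiplicative

variable {k : Type u} [Field k] {G : Type v} [Group G] [Fintype G] [DecidableEq G]

open DrinfeldDouble

namespace EquivariantBundle

theorem cls_toModule_stringyProduct (E F : EquivariantBundle k (ConjAct G) G) :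
    RepRing.cls (KFull.stringyProduct E F).toModule =
      RepRing.cls (FDModule.tensor E.toModule F.toModule) := by
  symm
  refine FDModule.cls_congr (M := FDModule.tensor E.toModule F.toModule)
    (N := (KFull.stringyProduct E F).toModule)
    (LinearEquiv.ofBijective (tensorPiMap (k := k) E.fib F.fib) tensorPiMap_bijective) ?_
  have hL : ∀ (q x : G) (v : ∀ g, E.fib g) (w : ∀ g, F.fib g),
      tensorRep E.toModule.ρ F.toModule.ρ (elt k q x) (v ⊗ₜ[k] w) =
      ∑ p : G × G with p.1 * p.2 = q, E.doubleAct p.1 x v ⊗ₜ[k] F.doubleAct p.2 x w := by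
    intro q x v w
    rw [tensorRep_apply, comul_elt, map_sum, LinearMap.sum_apply]
    refine Finset.sum_congr rfl fun p _ => ?_
    rw [outerTensorRep_tmul, toModule_rho_elt, toModule_rho_elt]
    rfl
  have key : ∀ q x : G, tensorPiMap (k := k) E.fib F.fib ∘ₗ
      tensorRep E.toModule.ρ F.toModule.ρ (elt k q x) =
      (KFull.stringyProduct E F).doubleAct q x ∘ₗ tensorPiMap (k := k) E.fib F.fib := by
    intro q x
    refine TensorProduct.ext' fun (v : ∀ g, E.fib g) (w : ∀ g, F.fib g) =>
      funext fun y => funext fun p => ?_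
    refine (congrArg (fun z => tensorPiMap (k := k) E.fib F.fib z y p) (hL q x v w)).trans ?_
    refine Eq.trans ?_ (congrFun ((KFull.stringyProduct E F).doubleAct_apply q x _ y) p).symm
    simp only [map_sum, Finset.sum_apply, tensorPiMap_tmul]
    by_cases hy : y = q
    · subst hy
      rw [if_pos rfl, Finset.sum_eq_single p.1]
      · rw [doubleAct_apply, doubleAct_apply, if_pos rfl, if_pos rfl]
        rfl
      · intro r _ hr
        rw [doubleAct_apply, doubleAct_apply]
        by_cases h1 : p.1.1 = r.1
        · have h2 : p.1.2 ≠ r.2 := fun h2 => hr (Prod.ext h1 h2).symm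
          rw [if_neg h2, TensorProduct.tmul_zero]
        · rw [if_neg h1, TensorProduct.zero_tmul]
      · intro h
        exact absurd (by simpa using p.2) h
    · rw [if_neg hy]
      refine Finset.sum_eq_zero fun r hr => ?_
      rw [doubleAct_apply, doubleAct_apply]
      by_cases h1 : p.1.1 = r.1
      · have h2 : p.1.2 ≠ r.2 := by
          intro h2
          apply hy
          rw [← p.2, h1, h2]
          simpa using hr
        rw [if_neg h2, TensorProduct.tmul_zero]
      · rw [if_neg h1, TensorProduct.zero_tmul]
  refine FDModule.intertwines_of_elt (M := FDModule.tensor E.toModule F.toModule)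
    (N := (KFull.stringyProduct E F).toModule) (tensorPiMap (k := k) E.fib F.fib) ?_
  intro q x t
  rw [toModule_rho_elt]
  exact DFunLike.congr_fun (key q x) t

theorem cls_toModule_untwisted :
    RepRing.cls (pushforward PointStack.untwisted
      (EquivariantBundle.trivial k (ConjAct G) PUnit.{v + 1})).toModule =
      RepRing.cls (FDModule.trivial k (DrinfeldDouble k G)) := by
  set U := pushforward (PointStack.untwisted (G := G))
      (EquivariantBundle.trivial k (ConjAct G) PUnit.{v + 1})
  let f : (∀ g : G, ∀ _ : {y : PUnit.{v + 1} // PointStack.untwisted (G := G) y = g},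
      ULift.{v} k) →ₗ[k] ULift.{max u v} k :=
    (ULift.moduleEquiv.trans ULift.moduleEquiv.symm).toLinearMap ∘ₗ LinearMap.proj (⟨PUnit.unit, rfl⟩ : {y : PUnit.{v + 1} // PointStack.untwisted (G := G) y = 1})
      ∘ₗ LinearMap.proj (1 : G)
  have hf : Function.Bijective f := by
    constructor
    · intro v w h
      funext g y
      obtain ⟨y, rfl⟩ := y
      have h' : (f v).down = (f w).down := congrArg _ h
      exact ULift.ext _ _ h'
    · exact fun c => ⟨fun _ _ => ⟨c.down⟩, rfl⟩
  refine FDModule.cls_congr (M := U.toModule) (N := FDModule.trivial k (DrinfeldDouble k G))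
    (LinearEquiv.ofBijective f hf) ?_
  refine FDModule.intertwines_of_elt (M := U.toModule)
    (N := FDModule.trivial k (DrinfeldDouble k G)) f ?_
  intro q x v
  have h1 : (FDModule.trivial k (DrinfeldDouble k G)).ρ (elt k q x) (f v) =
      Coalgebra.counit (R := k) (elt k q x) • f v := rfl
  rw [counit_elt] at h1
  refine Eq.trans ?_ h1.symm
  refine (congrArg (fun c : ULift.{v} k => (⟨c.down⟩ : ULift.{max u v} k))
    (congrFun (U.toModule_elt q x v 1) ⟨PUnit.unit, rfl⟩)).trans ?_
  by_cases hq : q = 1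
  · subst hq
    rw [if_pos rfl, if_pos rfl, one_smul]
    have key : ∀ (g : G) (y : {y : PUnit.{v + 1} // PointStack.untwisted (G := G) y = g}),
        (v : ∀ g : G, ∀ _ : {y : PUnit.{v + 1} // PointStack.untwisted (G := G) y = g},
          ULift.{v} k) g y = ⟨(f v).down⟩ := by
      rintro _ ⟨y, rfl⟩
      rfl
    exact congrArg (fun c : ULift.{v} k => (⟨c.down⟩ : ULift.{max u v} k)) (key _ _)
  · rw [if_neg (Ne.symm hq), if_neg hq, zero_smul]
    rfl

end EquivariantBundle

namespace KFull

/-- `K_full([pt/G])` is isomorphic to the representation ring of `D(k[G])`. -/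
def ringEquivRepRing : KFull k G ≃+* RepRing k (DrinfeldDouble k G) :=
  { (EquivariantK.addEquivRepRing :
      EquivariantK k (ConjAct G) G ≃+ RepRing k (DrinfeldDouble k G)) with
    map_mul' := by
      let Φ : EquivariantK k (ConjAct G) G →+ RepRing k (DrinfeldDouble k G) :=
        EquivariantK.addEquivRepRing.toAddMonoidHom
      have h0 : ∀ E F : EquivariantBundle k (ConjAct G) G, Φ (KFull.cls E * KFull.cls F) =
          Φ (KFull.cls E) * Φ (KFull.cls F) := by
        intro E F
        rw [KFull.cls_mul_cls]
        refine (EquivariantK.addEquivRepRing_cls _).trans ?_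
        rw [E.cls_toModule_stringyProduct, ← RepRing.cls_mul_cls,
          ← EquivariantK.addEquivRepRing_cls, ← EquivariantK.addEquivRepRing_cls]
        rfl
      have h1 : ∀ E : EquivariantBundle k (ConjAct G) G,
          Φ.comp (KFull.mulHom (KFull.cls E)) =
            (RepRing.mulHom (Φ (KFull.cls E))).comp Φ :=
        fun E => GrothendieckK.hom_ext fun F => h0 E F
      intro x y
      have h2 : Φ.comp (KFull.mulHom.flip y) = (RepRing.mulHom.flip (Φ y)).comp Φ :=
        GrothendieckK.hom_ext fun E => DFunLike.congr_fun (h1 E) y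
      exact DFunLike.congr_fun h2 x }

theorem ringEquivRepRing_one : (ringEquivRepRing : KFull k G ≃+* _) 1 = 1 :=
  (EquivariantK.addEquivRepRing_cls _).trans EquivariantBundle.cls_toModule_untwisted

end KFull

end Multiplicative

end

noncomputable section

/-! Decomposition of equivariant bundles along an invariant map -/

namespace EquivariantBundle

variable {k : Type u} [Field k] {Γ : Type v} [Group Γ] {X : Type v} [MulAction Γ X]
  {ι : Type*} (κ : X → ι) (hκ : ∀ (γ : Γ) (x : X), κ (γ • x) = κ x)

/-- The restriction of a bundle to the invariant subset `κ ⁻¹' S`, extended by zero. -/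
def restrict (E : EquivariantBundle k Γ X) (S : Set ι) : EquivariantBundle k Γ X where
  fib x := PLift (κ x ∈ S) → E.fib x
  act γ x _ h := LinearMap.pi fun p => E.act γ h ∘ₗ
    LinearMap.proj (⟨by rw [← hκ γ x, h]; exact p.down⟩ : PLift (κ x ∈ S))
  act_one x := LinearMap.ext fun v => funext fun p => DFunLike.congr_fun (E.act_one x) (v p)
  act_mul g h _ _ _ hx hy := LinearMap.ext fun v => funext fun p =>
    DFunLike.congr_fun (E.act_mul g h hx hy) (v _)

variable {κ}

theorem cls_restrict_union (E : EquivariantBundle k Γ X) {S T : Set ι} (hST : Disjoint S T) :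
    cls (E.restrict κ hκ (S ∪ T)) = cls (E.restrict κ hκ S) + cls (E.restrict κ hκ T) := by
  classical
  let f : ∀ x, (PLift (κ x ∈ S) → E.fib x) →ₗ[k] (PLift (κ x ∈ S ∪ T) → E.fib x) := fun x =>
    LinearMap.pi fun _ => if h : κ x ∈ S then LinearMap.proj ⟨h⟩ else 0
  let g : ∀ x, (PLift (κ x ∈ S ∪ T) → E.fib x) →ₗ[k] (PLift (κ x ∈ T) → E.fib x) := fun x =>
    LinearMap.pi fun p => LinearMap.proj ⟨Or.inr p.down⟩
  have hf : ∀ {x} (h : κ x ∈ S) (v) (p), f x v p = v ⟨h⟩ := by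
    intro x h v p
    simp [f, h]
  have hf' : ∀ {x} (_ : κ x ∉ S) (v) (p), f x v p = 0 := by
    intro x h v p
    simp [f, h]
  refine GrothendieckK.cls_eq_add ⟨f, g, ?_, ?_, fun x => ⟨?_, ?_, ?_⟩⟩
  · intro γ x y h v
    funext p
    by_cases hy : κ y ∈ S
    · have hx : κ x ∈ S := by rwa [← hκ γ x, h]
      refine (hf hy _ p).trans ?_
      exact congrArg (E.act γ h) (hf hx v ⟨Or.inl hx⟩).symm
    · have hx : κ x ∉ S := by rwa [← hκ γ x, h]
      have hp : κ x ∈ S ∪ T := by rw [← hκ γ x, h]; exact p.down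
      refine (hf' hy _ p).trans ?_
      exact (map_zero (E.act γ h)).symm.trans (congrArg (E.act γ h) (hf' hx v ⟨hp⟩).symm)
  · exact fun _ _ _ _ _ => rfl
  · intro v w hvw
    funext p
    have := congrFun hvw ⟨Or.inl p.down⟩
    exact (hf p.down v _).symm.trans (this.trans (hf p.down w _))
  · intro v
    constructor
    · intro hv
      refine ⟨fun p => v ⟨Or.inl p.down⟩, funext fun p => ?_⟩
      by_cases h : κ x ∈ S
      · exact hf h _ p
      · exact (hf' h _ p).trans (congrFun hv ⟨p.down.resolve_left h⟩).symm
    · rintro ⟨w, rfl⟩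
      exact funext fun p => hf' (fun h => Set.disjoint_left.1 hST h p.down) w ⟨Or.inr p.down⟩
  · exact fun v => ⟨fun p => if h : κ x ∈ T then v ⟨h⟩ else 0,
      funext fun p => dif_pos p.down⟩

theorem cls_eq_sum_restrict [Fintype ι] (E : EquivariantBundle k Γ X) :
    cls E = ∑ i, cls (E.restrict κ hκ {i}) := by
  classical
  have h : ∀ T : Finset ι, cls (E.restrict κ hκ (T : Set ι)) =
      ∑ i ∈ T, cls (E.restrict κ hκ {i}) := by
    intro T
    induction T using Finset.induction_on with
    | empty =>
      rw [Finset.sum_empty]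
      exact cls_zero fun x => ⟨fun v w => funext fun p =>
        absurd p.down (by rw [Finset.coe_empty]; exact Set.notMem_empty _)⟩
    | insert a T ha ih =>
      rw [Finset.sum_insert ha, ← ih, ← cls_restrict_union hκ E (Set.disjoint_singleton_left.2
        (by simpa using ha)), Finset.coe_insert, Set.insert_eq]
  rw [← h]
  symm
  have hmem : ∀ x, κ x ∈ ((Finset.univ : Finset ι) : Set ι) := fun x => by simp
  let f : ∀ x, (PLift (κ x ∈ ((Finset.univ : Finset ι) : Set ι)) → E.fib x) →ₗ[k] E.fib x :=
    fun x => LinearMap.proj ⟨hmem x⟩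
  have hf : ∀ x, Function.Bijective (f x) := fun x =>
    ⟨fun _ _ h => funext fun _ => h, fun w => ⟨fun _ => w, rfl⟩⟩
  refine cls_congr (M := E.restrict κ hκ _) (fun x => LinearEquiv.ofBijective (f x) (hf x)) ?_
  exact fun _ _ _ _ _ => rfl

end EquivariantBundle

namespace FDModule

/-- A linear map commuting with the group elements is a morphism of modules over `k[H]`. -/
theorem intertwines_of_group {k : Type u} [Field k] {H : Type v} [Group H]
    {M N : FDModule k (MonoidAlgebra k H)} (f : M.V →ₗ[k] N.V)
    (h : ∀ z v, f (M.ρ (MonoidAlgebra.of k H z) v) = N.ρ (MonoidAlgebra.of k H z) (f v))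
    (a : MonoidAlgebra k H) (v : M.V) : f (M.ρ a v) = N.ρ a (f v) := by
  induction a using MonoidAlgebra.induction_on with
  | of z => exact h z v
  | add a b ha hb => simp only [map_add, LinearMap.add_apply, ha, hb]
  | smul c a ha => simp only [map_smul, LinearMap.smul_apply, ha]

theorem ofRepresentation_of {k : Type u} [Field k] {H : Type v} [Group H] {V : Type (max u v)}
    [AddCommGroup V] [Module k V] [FiniteDimensional k V] (ρ : Representation k H V) (z : H) :
    (ofRepresentation ρ).ρ (MonoidAlgebra.of k H z) = ρ z :=
  Representation.asAlgebraHom_of ρ z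

end FDModule

/-! Induced bundles -/

section Induced

variable {k : Type u} [Field k] {G : Type v} [Group G] {g : G}

namespace FDModule

/-- The fibre of the induced bundle: equivariant functions on the group elements which carry
`g` to `x`. -/
def inducedFib (W : FDModule k (MonoidAlgebra k (Subgroup.centralizer ({g} : Set G)))) (x : G) :
    Submodule k ({h : G // ConjAct.toConjAct h • g = x} → W.V) where
  carrier := {f | ∀ (h h' : {h : G // ConjAct.toConjAct h • g = x})
    (z : Subgroup.centralizer ({g} : Set G)), h'.1 = h.1 * z →
      W.ρ (MonoidAlgebra.of k _ z) (f h') = f h}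
  add_mem' hf hf' h h' z hz := by
    rw [Pi.add_apply, map_add, hf h h' z hz, hf' h h' z hz, Pi.add_apply]
  zero_mem' h h' z hz := map_zero _
  smul_mem' c f hf h h' z hz := by
    rw [Pi.smul_apply, map_smul, hf h h' z hz, Pi.smul_apply]

variable (W : FDModule k (MonoidAlgebra k (Subgroup.centralizer ({g} : Set G))))

theorem inv_mul_mem_centralizer {x : G} (h h' : {h : G // ConjAct.toConjAct h • g = x}) :
    h.1⁻¹ * h'.1 ∈ Subgroup.centralizer ({g} : Set G) := by
  have h1 := h.2.trans h'.2.symm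
  rw [ConjAct.toConjAct_smul, ConjAct.toConjAct_smul] at h1
  rw [Subgroup.mem_centralizer_singleton_iff]
  have h2 : h'.1 * g = h.1 * g * h.1⁻¹ * h'.1 := by rw [h1]; group
  rw [mul_assoc, h2]
  group

/-- Evaluation at a group element carrying `g` to `x` identifies the fibre at `x` of the induced
bundle with the representation. -/
def inducedEval {x : G} (h₀ : {h : G // ConjAct.toConjAct h • g = x}) :
    W.inducedFib x ≃ₗ[k] W.V where
  toFun f := f.1 h₀
  map_add' _ _ := rfl
  map_smul' _ _ := rfl
  invFun w := ⟨fun h => W.ρ (MonoidAlgebra.of k _ ⟨_, inv_mul_mem_centralizer h h₀⟩) w, by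
    intro h h' z hz
    rw [← Module.End.mul_apply, ← map_mul, ← map_mul]
    congr 4
    refine Subtype.ext ?_
    change z.1 * (h'.1⁻¹ * h₀.1) = h.1⁻¹ * h₀.1
    rw [hz]
    group⟩
  left_inv f := Subtype.ext (funext fun h => f.2 h h₀ _ (by simp))
  right_inv w := by
    have h1 : (⟨_, inv_mul_mem_centralizer h₀ h₀⟩ : Subgroup.centralizer ({g} : Set G)) = 1 :=
      Subtype.ext (inv_mul_cancel h₀.1)
    change W.ρ (MonoidAlgebra.of k _ ⟨_, inv_mul_mem_centralizer h₀ h₀⟩) w = w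
    rw [h1, map_one, map_one, Module.End.one_apply]

theorem inducedFib_subsingleton {x : G} (hx : IsEmpty {h : G // ConjAct.toConjAct h • g = x}) :
    Subsingleton (W.inducedFib x) :=
  ⟨fun _ _ => Subtype.ext (funext fun h => hx.elim h)⟩

theorem inv_mul_smul_eq {γ : ConjAct G} {x y : G} (h : γ • x = y)
    (a : {a : G // ConjAct.toConjAct a • g = y}) :
    ConjAct.toConjAct ((ConjAct.ofConjAct γ)⁻¹ * a.1) • g = x := by
  rw [ConjAct.toConjAct_mul, mul_smul, a.2, ConjAct.toConjAct_inv, ConjAct.toConjAct_ofConjAct,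
    ← h, inv_smul_smul]

/-- The equivariant bundle on `G` induced by a representation of a centralizer. -/
def induced [Finite G] : EquivariantBundle k (ConjAct G) G where
  fib x := W.inducedFib x
  act γ x y h := (LinearMap.pi fun a => LinearMap.proj (⟨_, inv_mul_smul_eq h a⟩ :
      {a : G // ConjAct.toConjAct a • g = x})).restrict
    (fun f hf a a' z hz => hf _ _ z (by
      change (ConjAct.ofConjAct γ)⁻¹ * a'.1 = (ConjAct.ofConjAct γ)⁻¹ * a.1 * z
      rw [hz, mul_assoc]))
  act_one x := LinearMap.ext fun f => Subtype.ext (funext fun a =>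
    congrArg f.1 (Subtype.ext (by simp)))
  act_mul γ γ' x y z hx hy := LinearMap.ext fun f => Subtype.ext (funext fun a =>
    congrArg f.1 (Subtype.ext (by
      change (ConjAct.ofConjAct (γ * γ'))⁻¹ * a.1 =
        (ConjAct.ofConjAct γ')⁻¹ * ((ConjAct.ofConjAct γ)⁻¹ * a.1)
      rw [ConjAct.ofConjAct_mul, mul_inv_rev, mul_assoc])))

theorem isSES_induced [Finite G]
    (L M N : FDModule k (MonoidAlgebra k (Subgroup.centralizer ({g} : Set G)))) (h : IsSES L M N) :
    EquivariantBundle.IsSES L.induced M.induced N.induced := by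
  obtain ⟨f, p, hf, hp, hi, he, hs⟩ := h
  let F : ∀ {E E' : FDModule k (MonoidAlgebra k (Subgroup.centralizer ({g} : Set G)))}
      (f : E.V →ₗ[k] E'.V) (_ : ∀ a v, f (E.ρ a v) = E'.ρ a (f v)) (x : G),
      E.inducedFib x →ₗ[k] E'.inducedFib x := fun f hf x =>
    (LinearMap.pi fun a => f ∘ₗ LinearMap.proj a).restrict fun s hs a a' z hz =>
      (hf _ _).symm.trans (congrArg f (hs a a' z hz))
  refine ⟨F f hf, F p hp, fun _ _ _ _ _ => rfl, fun _ _ _ _ _ => rfl, fun x => ?_⟩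
  rcases isEmpty_or_nonempty {h : G // ConjAct.toConjAct h • g = x} with hx | ⟨⟨h₀⟩⟩
  · have h1 := L.inducedFib_subsingleton hx
    have h2 := M.inducedFib_subsingleton hx
    have h3 := N.inducedFib_subsingleton hx
    exact ⟨fun _ _ _ => h1.elim _ _, fun v => ⟨fun _ => ⟨0, h2.elim _ _⟩, fun _ => h3.elim _ _⟩,
      fun v => ⟨0, h3.elim _ _⟩⟩
  · refine ⟨?_, ?_, ?_⟩
    · exact fun v w hvw => (L.inducedEval h₀).injective
        (hi (congrArg (fun s : M.inducedFib x => M.inducedEval h₀ s) hvw))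
    · exact (Function.Exact.iff_of_ladder_linearEquiv (e₁ := L.inducedEval h₀)
        (e₂ := M.inducedEval h₀) (e₃ := N.inducedEval h₀) (f₁₂ := F f hf x) (f₂₃ := F p hp x)
        rfl rfl).1 he
    · intro v
      obtain ⟨w, hw⟩ := hs (N.inducedEval h₀ v)
      refine ⟨(M.inducedEval h₀).symm w, (N.inducedEval h₀).injective ?_⟩
      refine Eq.trans ?_ hw
      exact congrArg p ((M.inducedEval h₀).apply_symm_apply w)

theorem cls_sectorRep_induced [Finite G] :
    RepRing.cls (ofRepresentation (W.induced.sectorRep g)) = RepRing.cls W := by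
  have h1 : ConjAct.toConjAct (1 : G) • g = g := by rw [ConjAct.toConjAct_one, one_smul]
  refine cls_congr (M := ofRepresentation (W.induced.sectorRep g)) (W.inducedEval ⟨1, h1⟩) ?_
  refine intertwines_of_group (M := ofRepresentation (W.induced.sectorRep g)) (N := W)
    (W.inducedEval ⟨1, h1⟩).toLinearMap fun z f => ?_
  rw [ofRepresentation_of]
  exact ((f : W.inducedFib g).2 _ ⟨1, h1⟩ z (by simp)).symm

theorem cls_sectorRep_induced_of_not_isConj [Finite G] {g' : G} (h : ¬ IsConj g g') :
    RepRing.cls (ofRepresentation (W.induced.sectorRep g')) = 0 :=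
  cls_zero (W.inducedFib_subsingleton ⟨fun a => h (isConj_iff.2 ⟨a.1, by
    rw [← ConjAct.toConjAct_smul]; exact a.2⟩)⟩)

end FDModule

namespace EquivariantBundle

theorem isSES_sectorRep (L M N : EquivariantBundle k (ConjAct G) G) (h : IsSES L M N) (g : G) :
    FDModule.IsSES (FDModule.ofRepresentation (L.sectorRep g))
      (FDModule.ofRepresentation (M.sectorRep g)) (FDModule.ofRepresentation (N.sectorRep g)) := by
  obtain ⟨f, p, hf, hp, he⟩ := h
  refine ⟨f g, p g, ?_, ?_, he g⟩
  · refine FDModule.intertwines_of_group (M := FDModule.ofRepresentation (L.sectorRep g))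
      (N := FDModule.ofRepresentation (M.sectorRep g)) (f g) fun z v => ?_
    rw [FDModule.ofRepresentation_of, FDModule.ofRepresentation_of]
    exact hf _ _ v
  · refine FDModule.intertwines_of_group (M := FDModule.ofRepresentation (M.sectorRep g))
      (N := FDModule.ofRepresentation (N.sectorRep g)) (p g) fun z v => ?_
    rw [FDModule.ofRepresentation_of, FDModule.ofRepresentation_of]
    exact hp _ _ v

theorem conjClasses_mk_smul (γ : ConjAct G) (x : G) :
    ConjClasses.mk (γ • x) = ConjClasses.mk x :=
  ConjClasses.mk_eq_mk_iff_isConj.2 (isConj_iff.2 ⟨ConjAct.ofConjAct γ, rfl⟩).symm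

theorem cls_restrict_conjClass [Finite G] (E : EquivariantBundle k (ConjAct G) G) (g : G) :
    cls (E.restrict ConjClasses.mk conjClasses_mk_smul {ConjClasses.mk g}) =
      cls (FDModule.ofRepresentation (E.sectorRep g)).induced := by
  let W := FDModule.ofRepresentation (E.sectorRep g)
  have hinv : ∀ {x : G} (a : {a : G // ConjAct.toConjAct a • g = x}),
      (ConjAct.toConjAct a.1)⁻¹ • x = g := fun a => inv_smul_eq_iff.2 a.2.symm
  have hmem : ∀ {x : G} (_ : {a : G // ConjAct.toConjAct a • g = x}),
      ConjClasses.mk x ∈ ({ConjClasses.mk g} : Set (ConjClasses G)) := by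
    rintro _ ⟨a, rfl⟩
    exact conjClasses_mk_smul _ _
  let f : ∀ x, (PLift (ConjClasses.mk x ∈ ({ConjClasses.mk g} : Set (ConjClasses G))) → E.fib x)
      →ₗ[k] W.inducedFib x := fun x => LinearMap.codRestrict _
    (LinearMap.pi fun a => E.act (ConjAct.toConjAct a.1)⁻¹ (hinv a) ∘ₗ LinearMap.proj ⟨hmem a⟩)
    (by
      intro v a a' z hz
      refine (DFunLike.congr_fun (FDModule.ofRepresentation_of (E.sectorRep g) z) _).trans ?_
      refine E.act_act ?_ _ _ _ _
      rw [hz, ConjAct.toConjAct_mul, mul_inv_rev, mul_inv_cancel_left])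
  have hf : ∀ x, Function.Bijective (f x) := by
    intro x
    rcases isEmpty_or_nonempty {a : G // ConjAct.toConjAct a • g = x} with hx | ⟨⟨a⟩⟩
    · have h1 := W.inducedFib_subsingleton hx
      refine ⟨fun v w _ => funext fun p => ?_, fun v => ⟨0, h1.elim _ _⟩⟩
      obtain ⟨b, hb⟩ := isConj_iff.1 (ConjClasses.mk_eq_mk_iff_isConj.1 p.down).symm
      exact hx.elim ⟨b, by rw [ConjAct.toConjAct_smul]; exact hb⟩
    · constructor
      · intro v w hvw
        funext p
        have h1 : E.act (ConjAct.toConjAct a.1)⁻¹ (hinv a) (v p) =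
          E.act (ConjAct.toConjAct a.1)⁻¹ (hinv a) (w p) := congrFun (congrArg Subtype.val hvw) a
        have h2 := congrArg (E.act (ConjAct.toConjAct a.1) a.2) h1
        rwa [E.act_act (mul_inv_cancel _) _ _ (one_smul _ x),
          E.act_act (mul_inv_cancel _) _ _ (one_smul _ x), E.act_eq_self rfl,
          E.act_eq_self rfl] at h2
      · intro s
        refine ⟨fun _ => E.act (ConjAct.toConjAct a.1) a.2 (W.inducedEval a s),
          (W.inducedEval a).injective ?_⟩
        refine (E.act_act (inv_mul_cancel _) _ _ (one_smul _ g) _).trans ?_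
        exact E.act_eq_self rfl _ _
  refine cls_congr (M := E.restrict ConjClasses.mk conjClasses_mk_smul {ConjClasses.mk g})
    (N := W.induced) (fun x => LinearEquiv.ofBijective (f x) (hf x)) ?_
  intro γ x y h v
  refine Subtype.ext (funext fun a => ?_)
  refine E.act_act ?_ _ _ _ _
  simp

end EquivariantBundle

namespace EquivariantK

variable (r : ConjClasses G → G)

/-- The classes of the fibres at the points `r c`, as representations of the centralizers. -/
def sector : EquivariantK k (ConjAct G) G →+
    ∀ c, RepRing k (MonoidAlgebra k (Subgroup.centralizer ({r c} : Set G))) :=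
  AddMonoidHom.mk' (fun x c => GrothendieckK.lift
    (fun E => RepRing.cls (FDModule.ofRepresentation (EquivariantBundle.sectorRep E (r c))))
    (fun _ _ _ h => GrothendieckK.cls_eq_add (EquivariantBundle.isSES_sectorRep _ _ _ h (r c))) x)
    fun x y => funext fun _ => map_add _ x y

theorem sector_cls (E : EquivariantBundle k (ConjAct G) G) (c : ConjClasses G) :
    sector r (EquivariantBundle.cls E) c =
      RepRing.cls (FDModule.ofRepresentation (E.sectorRep (r c))) :=
  GrothendieckK.lift_cls
    (fun E => RepRing.cls (FDModule.ofRepresentation (EquivariantBundle.sectorRep E (r c))))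
    (fun _ _ _ h => GrothendieckK.cls_eq_add (EquivariantBundle.isSES_sectorRep _ _ _ h (r c))) E

/-- Induction of representations of a centralizer to equivariant bundles. -/
def induction [Finite G] (g : G) : RepRing k (MonoidAlgebra k (Subgroup.centralizer ({g} : Set G))) →+
    EquivariantK k (ConjAct G) G :=
  GrothendieckK.lift (fun W => EquivariantBundle.cls (FDModule.induced W))
    (fun _ _ _ h => GrothendieckK.cls_eq_add (FDModule.isSES_induced _ _ _ h))

theorem induction_cls [Finite G] {g : G}
    (W : FDModule k (MonoidAlgebra k (Subgroup.centralizer ({g} : Set G)))) :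
    induction g (RepRing.cls W) = EquivariantBundle.cls W.induced :=
  GrothendieckK.lift_cls (fun W => EquivariantBundle.cls (FDModule.induced W))
    (fun _ _ _ h => GrothendieckK.cls_eq_add (FDModule.isSES_induced _ _ _ h)) W

theorem sum_induction_sector [Finite G] [Fintype (ConjClasses G)] {r : ConjClasses G → G} (hr : ∀ c, ConjClasses.mk (r c) = c)
    (x : EquivariantK k (ConjAct G) G) : ∑ c, induction (r c) (sector r x c) = x := by
  let Θ : EquivariantK k (ConjAct G) G →+ EquivariantK k (ConjAct G) G :=
    ∑ c, (induction (r c)).comp ((Pi.evalAddMonoidHom _ c).comp (sector r))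
  have hΘ : ∀ x, Θ x = ∑ c, induction (r c) (sector r x c) := fun x => by
    simp only [Θ, AddMonoidHom.finsetSum_apply]
    rfl
  have : Θ = AddMonoidHom.id _ := GrothendieckK.hom_ext fun E => by
    refine (hΘ _).trans (Eq.trans ?_
      (E.cls_eq_sum_restrict EquivariantBundle.conjClasses_mk_smul).symm)
    refine Finset.sum_congr rfl fun c _ => ?_
    refine (congrArg (induction (r c)) (sector_cls r E c)).trans ?_
    rw [induction_cls, ← E.cls_restrict_conjClass, hr]
  rw [← hΘ, this]
  rfl

theorem sector_induction_self [Finite G] {r : ConjClasses G → G} {c : ConjClasses G}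
    (y : RepRing k (MonoidAlgebra k (Subgroup.centralizer ({r c} : Set G)))) :
    sector r (induction (r c) y) c = y := by
  have : ((Pi.evalAddMonoidHom _ c).comp (sector r)).comp (induction (r c)) =
      AddMonoidHom.id (RepRing k (MonoidAlgebra k (Subgroup.centralizer ({r c} : Set G)))) :=
    GrothendieckK.hom_ext fun W => by
      refine (congrArg (fun x => sector r x c) (induction_cls W)).trans ?_
      exact (sector_cls r _ c).trans W.cls_sectorRep_induced
  exact DFunLike.congr_fun this y

theorem sector_induction_ne [Finite G] {r : ConjClasses G → G} (hr : ∀ c, ConjClasses.mk (r c) = c)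
    {c d : ConjClasses G} (h : c ≠ d)
    (y : RepRing k (MonoidAlgebra k (Subgroup.centralizer ({r c} : Set G)))) :
    sector r (induction (r c) y) d = 0 := by
  have : ((Pi.evalAddMonoidHom _ d).comp (sector r)).comp (induction (r c)) =
      (0 : _ →+ RepRing k (MonoidAlgebra k (Subgroup.centralizer ({r d} : Set G)))) :=
    GrothendieckK.hom_ext fun W => by
      refine (congrArg (fun x => sector r x d) (induction_cls W)).trans ?_
      refine (sector_cls r _ d).trans (W.cls_sectorRep_induced_of_not_isConj fun hc => h ?_)
      rw [← hr c, ← hr d]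
      exact ConjClasses.mk_eq_mk_iff_isConj.2 hc
  exact DFunLike.congr_fun this y

/-- `K([G/G])` is the direct sum of the representation groups of the centralizers of
representatives of the conjugacy classes. -/
def sectorEquiv [Finite G] [Fintype (ConjClasses G)] {r : ConjClasses G → G} (hr : ∀ c, ConjClasses.mk (r c) = c) :
    EquivariantK k (ConjAct G) G ≃+
      ⨁ c, RepRing k (MonoidAlgebra k (Subgroup.centralizer ({r c} : Set G))) :=
  AddEquiv.trans
    { sector r with
      invFun := fun y => ∑ c, induction (r c) (y c)
      left_inv := sum_induction_sector hr
      right_inv := fun y => funext fun d => by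
        change sector r (∑ c, induction (r c) (y c)) d = y d
        rw [map_sum, Finset.sum_apply, Finset.sum_eq_single d]
        · exact sector_induction_self (y d)
        · exact fun c _ h => sector_induction_ne hr h (y c)
        · simp }
    (DirectSum.addEquivProd _).symm

theorem sectorEquiv_cls [Finite G] [Fintype (ConjClasses G)] {r : ConjClasses G → G} (hr : ∀ c, ConjClasses.mk (r c) = c)
    (E : EquivariantBundle k (ConjAct G) G) (c : ConjClasses G) :
    sectorEquiv hr (EquivariantBundle.cls E) c =
      RepRing.cls (FDModule.ofRepresentation (E.sectorRep (r c))) :=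
  (congrFun ((DirectSum.addEquivProd _).apply_symm_apply (sector r (EquivariantBundle.cls E)))
    c).trans (sector_cls r E c)

end EquivariantK

end Induced

end

theorem mainTheorem1 (k : Type u) [Field k] (G : Type v) [Group G] [Fintype G] [DecidableEq G] :
    (∃ Φ : KFull k G ≃+* RepRing k (DrinfeldDouble k G), Φ 1 = 1) ∧
    (∀ r : ConjClasses G → G, (∀ c, ConjClasses.mk (r c) = c) →
      ∃ Ψ : KFull k G ≃+ ⨁ c : ConjClasses G,
          RepRing k (MonoidAlgebra k (Subgroup.centralizer ({r c} : Set G))),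
        ∀ (E : EquivariantBundle k (ConjAct G) G) (c : ConjClasses G),
          Ψ (KFull.cls E) c = RepRing.cls (FDModule.ofRepresentation (E.sectorRep (r c)))) := by
  refine ⟨⟨KFull.ringEquivRepRing, KFull.ringEquivRepRing_one⟩, fun r hr => ?_⟩
  have := Fintype.ofFinite (ConjClasses G)
  exact ⟨EquivariantK.sectorEquiv hr, EquivariantK.sectorEquiv_cls hr⟩
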